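/- Let $d\ge 0$, let $\Omega\subset\mathbb{C}^d$ be a domain (a non-empty connected open set, possibly unbounded), and let $\|\cdot\|$ be the Euclidean norm. Let $\mathbb{D}$ be the open unit disc with Poincaré distance $\rho(a,b)=\tanh^{-1}\left|\frac{a-b}{1-\bar a b}\right|$. Let $K_\Omega(z,w)$ be the Kobayashi pseudo-distance, that is, the infimum of $\sum_j\rho(a_j,b_j)$ over all finite chains of holomorphic maps $f_j:\mathbb{D}\to\Omega$ and points $a_j,b_j\in\mathbb{D}$, $1\le j\le m$, with $f_1(a_1)=z$, $f_j(b_j)=f_{j+1}(a_{j+1})$ and $f_m(b_m)=w$. Let $$k_\Omega(z;v)=\inf\{|\zeta| : f:\mathbb{D}\to\Omega \text{ holomorphic},\ \zeta\in\mathbb{C},\ f(0)=z,\ \zeta f'(0)=v\}$$ be the infinitesimal Kobayashi pseudo-metric. $\Omega$ is Kobayashi hyperbolic if $K_\Omega$ is a distance, i.e. $K_\Omega(z,w)=0$ implies $z=w$. Local Goldilocks points. Write $\delta_\Omega(z)$ for the Euclidean distance from $z$ to $\partial\Omega$ and, for $U\subset\overline\Omega$, $$M_{\Omega,U}(r)=\sup\left\{\frac{1}{k_\Omega(z;v)}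 : z\in\Omega\cap U,\ \delta_\Omega(z)\le r,\ \|v\|=1\right\}\in[0,\infty].$$ A point $x\in\partial\Omega$ is a local Goldilocks point if it has a neighbourhood $U$ in $\overline\Omega$ such that (1) $\int_0^\epsilon \frac1r M_{\Omega,U}(r)\,dr<\infty$ for some $\epsilon>0$, and (2) for each $z_0\in\Omega$ there are constants $C,\alpha>0$ with $K_\Omega(z_0,z)\le C+\alpha\log\frac{1}{\delta_\Omega(z)}$ for all $z\in\Omega\cap U$. Let $\partial_{\rm lg}\Omega\subset\partial\Omega$ be the set of local Goldilocks points. Almost-geodesics. For $\lambda\ge1$ and $\kappa\ge0$, a $(\lambda,\kappa)$-almost-geodesic is an absolutely continuous map $\sigma:[a,b]\to\Omega$ such that $\lambda^{-1}|t-s|-\kappa\le K_\Omega(\sigma(t),\sigma(s))\le\lambda|t-s|+\kappa$ for all $s,t\in[a,b]$, and $k_\Omega(\sigma(t);\sigma'(t))\le\lambda$ for almost every $t\in[a,b]$. End compactification. An end $e$ of $\overline\Omega$ is a choice, for every compact $K\subset\overline\Omega$, of a connected component $U^{(e)}_K$ of $\overline\Omega\setminus K$, such that $U^{(e)}_L\subset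 U^{(e)}_K$ whenever $K\subset L$. The end compactification $\overline\Omega^{End}$ is the set $\overline\Omega$ together with all ends of $\overline\Omega$; a set $W\subset\overline\Omega^{End}$ is open if $W\cap\overline\Omega$ is open in $\overline\Omega$ and for every end $e\in W$ there is a compact $K$ such that $W$ contains $U^{(e)}_K$ and all ends $f$ with $U^{(f)}_K=U^{(e)}_K$. Put $\partial\overline\Omega^{End}=\overline\Omega^{End}\setminus\Omega$. Theorem. Suppose that $\Omega$ is Kobayashi hyperbolic and that $\partial\Omega\setminus\partial_{\rm lg}\Omega$ is totally disconnected. Then $\Omega$ is a visibility domain with respect to the Kobayashi distance. This means that $\Omega$ is Kobayashi hyperbolic and that, for all $\lambda\ge1$, $\kappa\ge0$, all distinct $\xi,\eta\in\partial\overline\Omega^{End}$, and all open neighbourhoods $V_\xi,V_\eta$ of $\xi,\eta$ in $\overline\Omega^{End}$ whose closures in $\overline\Omega^{End}$ are disjoint, there is a compact set $K\subset\Omega$ such that every $(\lambda,\kappa)$-almost-geodesic $\sigma:[0,T]\to\Omega$ with $\sigma(0)\in V_\xi$ and $\sigma(T)\in V_\eta$ satisfies $\sigma([0,T])\cap K\neq\emptyset$.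 -/

import Mathlib

open Set Filter Topology MeasureTheory

noncomputable section

/-! ### The Kobayashi pseudo-distance and the infinitesimal Kobayashi pseudo-metric -/

/-- Complex Euclidean space `ℂ^d`, with the Euclidean norm. -/
abbrev CSpace (d : ℕ) : Type := EuclideanSpace ℂ (Fin d)

/-- `f` restricts to a holomorphic map from the open unit disc into `Ω`. -/
def IsAnalyticDisc {d : ℕ} (Ω : Set (CSpace d)) (f : ℂ → CSpace d) : Prop :=
  DifferentiableOn ℂ f (Metric.ball 0 1) ∧ MapsTo f (Metric.ball 0 1) Ω

/-- The Poincaré distance of the unit disc, normalised so that its infinitesimal form is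
`|dz| / (1 - |z|²)`. -/
def poincareDist (a b : ℂ) : ℝ :=
  Real.artanh ‖(a - b) / (1 - (starRingEnd ℂ) a * b)‖

/-- `KobayashiChain Ω z w L`: the points `z` and `w` of `Ω` are joined by a finite chain of
analytic discs in `Ω` whose total Poincaré length is `L`. -/
inductive KobayashiChain {d : ℕ} (Ω : Set (CSpace d)) : CSpace d → CSpace d → ℝ → Prop
  | nil (z : CSpace d) (hz : z ∈ Ω) : KobayashiChain Ω z z 0
  | cons (f : ℂ → CSpace d) (hf : IsAnalyticDisc Ω f) (a b : ℂ)
      (ha : a ∈ Metric.ball (0 : ℂ) 1) (hb : b ∈ Metric.ball (0 : ℂ) 1)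
      (w : CSpace d) (L : ℝ) (h : KobayashiChain Ω (f b) w L) :
      KobayashiChain Ω (f a) w (poincareDist a b + L)

/-- The Kobayashi pseudo-distance `K_Ω(z, w)`. On a domain the set of lengths is non-empty for
all `z, w ∈ Ω`, and it is bounded below by `0`. -/
def kobayashiDist {d : ℕ} (Ω : Set (CSpace d)) (z w : CSpace d) : ℝ :=
  sInf {L : ℝ | KobayashiChain Ω z w L}

/-- The infinitesimal Kobayashi pseudo-metric `k_Ω(z; v)`: the infimum of `|ζ|` over all analytic
discs `f` in `Ω` with `f 0 = z` and `ζ f'(0) = v`. For `z` in an open `Ω` the set is non-empty. -/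
def kobayashiMetric {d : ℕ} (Ω : Set (CSpace d)) (z v : CSpace d) : ℝ :=
  sInf {r : ℝ | ∃ (f : ℂ → CSpace d) (ζ : ℂ),
    IsAnalyticDisc Ω f ∧ f 0 = z ∧ ζ • deriv f 0 = v ∧ r = ‖ζ‖}

/-- `Ω` is Kobayashi hyperbolic: the pseudo-distance `K_Ω` separates the points of `Ω`. -/
def IsKobayashiHyperbolic {d : ℕ} (Ω : Set (CSpace d)) : Prop :=
  ∀ z ∈ Ω, ∀ w ∈ Ω, kobayashiDist Ω z w = 0 → z = w

/-- `σ : [a, b] → Ω` is a `(lam, κ)`-almost-geodesic of `Ω`. -/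
structure IsAlmostGeodesic {d : ℕ} (Ω : Set (CSpace d)) (lam κ a b : ℝ)
    (σ : ℝ → CSpace d) : Prop where
  mem : ∀ t ∈ Icc a b, σ t ∈ Ω
  lower : ∀ s ∈ Icc a b, ∀ t ∈ Icc a b,
    lam⁻¹ * |t - s| - κ ≤ kobayashiDist Ω (σ t) (σ s)
  upper : ∀ s ∈ Icc a b, ∀ t ∈ Icc a b,
    kobayashiDist Ω (σ t) (σ s) ≤ lam * |t - s| + κ
  absolutelyContinuous : AbsolutelyContinuousOnInterval σ a b
  speed : ∀ᵐ t ∂(volume.restrict (Icc a b)), kobayashiMetric Ω (σ t) (deriv σ t) ≤ lam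

/-! ### The local Goldilocks property -/

/-- `δ_Ω(z)`, the Euclidean distance from `z` to the boundary of `Ω`. -/
def boundaryDist {d : ℕ} (Ω : Set (CSpace d)) (z : CSpace d) : ℝ :=
  Metric.infDist z (frontier Ω)

/-- `M_{Ω,U}(r)`, the supremum of `1 / k_Ω(z; v)` over `z ∈ Ω ∩ U` with `δ_Ω(z) ≤ r` and unit
vectors `v`, as an element of `[0, ∞]` (with `1 / 0 = ∞`). -/
def goldilocksM {d : ℕ} (Ω U : Set (CSpace d)) (r : ℝ) : ENNReal :=
  ⨆ (z : CSpace d) (v : CSpace d) (_ : z ∈ Ω ∩ U) (_ : boundaryDist Ω z ≤ r) (_ : ‖v‖ = 1),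
    (ENNReal.ofReal (kobayashiMetric Ω z v))⁻¹

/-- `x` is a local Goldilocks point of the boundary of `Ω`. -/
def IsLocalGoldilocksPoint {d : ℕ} (Ω : Set (CSpace d)) (x : CSpace d) : Prop :=
  x ∈ frontier Ω ∧ ∃ U : Set (CSpace d), U ⊆ closure Ω ∧ U ∈ 𝓝[closure Ω] x ∧
    (∃ ε : ℝ, 0 < ε ∧
      ∫⁻ r in Ioo 0 ε, (ENNReal.ofReal r)⁻¹ * goldilocksM Ω U r < ⊤) ∧
    (∀ z₀ ∈ Ω, ∃ C α : ℝ, 0 < C ∧ 0 < α ∧ ∀ z ∈ Ω ∩ U,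
      kobayashiDist Ω z₀ z ≤ C + α * Real.log (1 / boundaryDist Ω z))

/-- The set `∂_lg Ω` of local Goldilocks points. -/
def localGoldilocksBoundary {d : ℕ} (Ω : Set (CSpace d)) : Set (CSpace d) :=
  {x | IsLocalGoldilocksPoint Ω x}

/-! ### The end compactification -/

/-- An end of `X`: a choice, for each compact `K`, of a connected component of `X \ K`, decreasing
in `K`. Restricting `K` to an increasing sequence of compact sets whose interiors cover `X`
gives the same ends. -/
@[ext]
structure TopEnd (X : Type*) [TopologicalSpace X] where
  comp : TopologicalSpace.Compacts X → Set X
  isComponent : ∀ K : TopologicalSpace.Compacts X,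
    ∃ x ∈ (K : Set X)ᶜ, comp K = connectedComponentIn (K : Set X)ᶜ x
  anti : ∀ K L : TopologicalSpace.Compacts X, K ≤ L → comp L ⊆ comp K

/-- The end compactification of `X`, as a set: `X` together with its ends. -/
inductive EndCompactification (X : Type*) [TopologicalSpace X] : Type _
  | point (x : X) : EndCompactification X
  | ideal (e : TopEnd X) : EndCompactification X

/-- The basic neighbourhood of an end `e` given by a compact set `K`: the component of `X \ K`
chosen by `e`, together with all the ends that choose the same component. -/
def EndCompactification.basicNhd {X : Type*} [TopologicalSpace X] (e : TopEnd X)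
    (K : TopologicalSpace.Compacts X) : Set (EndCompactification X) :=
  EndCompactification.point '' e.comp K ∪ EndCompactification.ideal '' {f | f.comp K = e.comp K}

theorem EndCompactification.basicNhd_anti {X : Type*} [TopologicalSpace X] (e : TopEnd X)
    {K L : TopologicalSpace.Compacts X} (h : K ≤ L) :
    EndCompactification.basicNhd e L ⊆ EndCompactification.basicNhd e K := by
  rintro _ (⟨x, hx, rfl⟩ | ⟨f, hf, rfl⟩)
  · exact Or.inl ⟨x, e.anti K L h hx, rfl⟩
  · refine Or.inr ⟨f, ?_, rfl⟩
    obtain ⟨y, hy, hLy⟩ := f.isComponent L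
    have hyL : y ∈ f.comp L := hLy ▸ mem_connectedComponentIn hy
    have h1 : y ∈ f.comp K := f.anti K L h hyL
    have h2 : y ∈ e.comp K := e.anti K L h ((show f.comp L = e.comp L from hf) ▸ hyL)
    obtain ⟨a, -, ha⟩ := f.isComponent K
    obtain ⟨b, -, hb⟩ := e.isComponent K
    rw [ha] at h1
    rw [hb] at h2
    show f.comp K = e.comp K
    rw [ha, hb, connectedComponentIn_eq h1, connectedComponentIn_eq h2]

/-- The topology of the end compactification: `W` is open iff its trace on `X` is open in `X` and
`W` contains a basic neighbourhood of each of the ends in `W`. -/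
instance EndCompactification.topology (X : Type*) [TopologicalSpace X] :
    TopologicalSpace (EndCompactification X) where
  IsOpen W := IsOpen (EndCompactification.point ⁻¹' W) ∧
    ∀ e : TopEnd X, EndCompactification.ideal e ∈ W →
      ∃ K, EndCompactification.basicNhd e K ⊆ W
  isOpen_univ := ⟨by simp, fun _ _ => ⟨⊥, subset_univ _⟩⟩
  isOpen_inter := by
    rintro s t ⟨hs, hs'⟩ ⟨ht, ht'⟩
    refine ⟨by rw [preimage_inter]; exact hs.inter ht, fun e he => ?_⟩
    obtain ⟨K, hK⟩ := hs' e he.1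
    obtain ⟨L, hL⟩ := ht' e he.2
    exact ⟨K ⊔ L, subset_inter
      ((EndCompactification.basicNhd_anti e le_sup_left).trans hK)
      ((EndCompactification.basicNhd_anti e le_sup_right).trans hL)⟩
  isOpen_sUnion := by
    intro S hS
    refine ⟨?_, fun e he => ?_⟩
    · rw [preimage_sUnion]
      exact isOpen_biUnion fun s hs => (hS s hs).1
    · obtain ⟨s, hs, hes⟩ := he
      obtain ⟨K, hK⟩ := (hS s hs).2 e hes
      exact ⟨K, hK.trans (subset_sUnion_of_mem hs)⟩

/-- The end compactification of the closure of `Ω`. -/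
abbrev EndClosure {d : ℕ} (Ω : Set (CSpace d)) : Type :=
  EndCompactification (closure Ω)

/-- A point of `Ω`, viewed in the end compactification of the closure of `Ω`. -/
def EndClosure.ofMem {d : ℕ} {Ω : Set (CSpace d)} (z : CSpace d) (hz : z ∈ Ω) : EndClosure Ω :=
  EndCompactification.point ⟨z, subset_closure hz⟩

/-- The end-compactification boundary: the complement of `Ω` in the end compactification of the
closure of `Ω`. -/
def endBoundary {d : ℕ} (Ω : Set (CSpace d)) : Set (EndClosure Ω) :=
  {ξ | ∀ (z : CSpace d) (hz : z ∈ Ω), ξ ≠ EndClosure.ofMem z hz}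

/-! ### Visibility -/

/-- `Ω` is a visibility domain with respect to the Kobayashi distance. -/
def IsVisibilityDomain {d : ℕ} (Ω : Set (CSpace d)) : Prop :=
  IsKobayashiHyperbolic Ω ∧
  ∀ lam κ : ℝ, 1 ≤ lam → 0 ≤ κ →
  ∀ ξ ∈ endBoundary Ω, ∀ η ∈ endBoundary Ω, ξ ≠ η →
  ∀ Vξ Vη : Set (EndClosure Ω), IsOpen Vξ → IsOpen Vη → ξ ∈ Vξ → η ∈ Vη →
    Disjoint (closure Vξ) (closure Vη) →
  ∃ K : Set (CSpace d), IsCompact K ∧ K ⊆ Ω ∧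
    ∀ (T : ℝ) (σ : ℝ → CSpace d), 0 ≤ T → IsAlmostGeodesic Ω lam κ 0 T σ →
      ∀ (h₀ : σ 0 ∈ Ω) (hT : σ T ∈ Ω),
        EndClosure.ofMem (σ 0) h₀ ∈ Vξ → EndClosure.ofMem (σ T) hT ∈ Vη →
        (σ '' Icc 0 T ∩ K).Nonempty

end

noncomputable section

variable {d : ℕ} {Ω : Set (CSpace d)}

/-! ### The Poincaré distance and the automorphisms of the unit disc -/

/-! Argue by contradiction: for each compact `K ⊆ Ω` take an almost-geodesic that joins the two
neighbourhoods and misses `K`. Along an ultrafilter on the compact subsets of `Ω`, these curves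
leave every compact subset of `Ω`.

The analytic core is `exists_norm_sub_lt_of_boundaryDist_le`. On a curve near a local Goldilocks
point, the logarithmic bound on the distance and the lower almost-geodesic inequality make the
boundary distance decay exponentially in time away from its maximum. The Dini-type integral
condition then bounds the Euclidean length, and the bound is small when the curve stays in a thin
boundary layer. So a curve that travels a fixed Euclidean distance there meets a fixed compact
subset of `Ω` (`IsLocalGoldilocksPoint.exists_compact`). Hence escaping curves that accumulate at a
local Goldilocks point shrink to it.

An exceptional point has small neighbourhoods whose frontiers miss the closed, totally disconnected
exceptional set. Unless the curves shrink to some point, they avoid such a frontier and, being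
connected, are trapped inside or stay outside. This gives the dichotomy
`exists_eventually_subset_closedBall_or_eventually_disjoint`: the curves shrink to one point of the
closure, or they leave every compact set of `ℂ^d`.

If they shrink to a point, that point lies in both closures of the neighbourhoods. Otherwise the
initial points go to infinity and select an end (`exists_topEnd_of_tendsto_infinity`), and
connectedness of the curves forces the final points to select the same end. Either way the closures
meet. To select an end, the points are joined to a base point by (1,1)-almost-geodesics, and the
local estimate shows that these pass near a common point far from the origin. -/

theorem poincareDist_nonneg (a b : ℂ) : 0 ≤ poincareDist a b :=
  Real.artanh_nonneg (norm_nonneg _)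

theorem poincareDist_comm (a b : ℂ) : poincareDist a b = poincareDist b a := by
  unfold poincareDist
  congr 1
  rw [norm_div, norm_div, norm_sub_rev a b,
    ← RCLike.norm_conj (1 - (starRingEnd ℂ) a * b)]
  simp [mul_comm]

theorem normSq_mobius_identity (a z : ℂ) :
    ‖1 + (starRingEnd ℂ) a * z‖ ^ 2 - ‖z + a‖ ^ 2 = (1 - ‖a‖ ^ 2) * (1 - ‖z‖ ^ 2) := by
  simp only [← Complex.normSq_eq_norm_sq, Complex.normSq_apply, Complex.add_re, Complex.add_im,
    Complex.mul_re, Complex.mul_im, Complex.conj_re, Complex.conj_im, Complex.one_re,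
    Complex.one_im]
  ring

/-- The automorphism of the unit disc that takes `0` to `a` and has positive derivative there. -/
def mobius (a z : ℂ) : ℂ := (z + a) / (1 + (starRingEnd ℂ) a * z)

theorem one_add_conj_mul_ne_zero {a z : ℂ} (ha : ‖a‖ < 1) (hz : ‖z‖ < 1) :
    1 + (starRingEnd ℂ) a * z ≠ 0 := by
  intro h
  have h1 : ‖(starRingEnd ℂ) a * z‖ = 1 := by
    rw [eq_neg_of_add_eq_zero_right h]; simp
  rw [norm_mul, RCLike.norm_conj] at h1
  nlinarith [norm_nonneg a, norm_nonneg z]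

theorem norm_mobius_lt_one {a z : ℂ} (ha : ‖a‖ < 1) (hz : ‖z‖ < 1) : ‖mobius a z‖ < 1 := by
  have h := normSq_mobius_identity a z
  have h0 : 0 < ‖1 + (starRingEnd ℂ) a * z‖ := norm_pos_iff.2 (one_add_conj_mul_ne_zero ha hz)
  rw [mobius, norm_div, div_lt_one h0]
  have h1 : 0 < (1 - ‖a‖ ^ 2) * (1 - ‖z‖ ^ 2) := by
    apply mul_pos <;> nlinarith [norm_nonneg a, norm_nonneg z]
  exact lt_of_pow_lt_pow_left₀ 2 h0.le (by linarith)

theorem mobius_zero (a : ℂ) : mobius a 0 = a := by simp [mobius]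

theorem hasDerivAt_mobius {a z : ℂ} (ha : ‖a‖ < 1) (hz : ‖z‖ < 1) :
    HasDerivAt (mobius a) ((1 - ‖a‖ ^ 2 : ℝ) / (1 + (starRingEnd ℂ) a * z) ^ 2) z := by
  have h1 : HasDerivAt (fun z : ℂ => z + a) 1 z := (hasDerivAt_id z).add_const a
  have h2 : HasDerivAt (fun z : ℂ => 1 + (starRingEnd ℂ) a * z) ((starRingEnd ℂ) a) z := by
    simpa using ((hasDerivAt_id z).const_mul ((starRingEnd ℂ) a)).const_add 1
  have h3 := h1.div h2 (one_add_conj_mul_ne_zero ha hz)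
  convert! h3 using 1
  congr 1
  have : ((‖a‖ ^ 2 : ℝ) : ℂ) = a * (starRingEnd ℂ) a := by
    rw [Complex.mul_conj, Complex.normSq_eq_norm_sq]
  rw [Complex.ofReal_sub, this]
  push_cast
  ring

theorem mobius_right_inv {a b : ℂ} (ha : ‖a‖ < 1) (hb : ‖b‖ < 1) :
    mobius a ((b - a) / (1 - (starRingEnd ℂ) a * b)) = b := by
  have h1 : 1 - (starRingEnd ℂ) a * b ≠ 0 := by
    have := one_add_conj_mul_ne_zero (a := -a) (z := b) (by simpa) hb
    simpa [← sub_eq_add_neg] using this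
  have h2 : 1 - a * (starRingEnd ℂ) a ≠ 0 := by
    rw [Complex.mul_conj, Complex.normSq_eq_norm_sq]
    norm_cast
    nlinarith [norm_nonneg a]
  unfold mobius
  have h3 : 1 + (starRingEnd ℂ) a * ((b - a) / (1 - (starRingEnd ℂ) a * b))
      = (1 - a * (starRingEnd ℂ) a) / (1 - (starRingEnd ℂ) a * b) := by
    field_simp; ring
  have h4 : (b - a) / (1 - (starRingEnd ℂ) a * b) + a
      = b * (1 - a * (starRingEnd ℂ) a) / (1 - (starRingEnd ℂ) a * b) := by
    rw [eq_div_iff h1, add_mul, div_mul_cancel₀ _ h1]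
    ring
  rw [h3, h4, div_div_div_cancel_right₀ h1, mul_div_assoc, div_self h2, mul_one]

theorem norm_mobius_inv_lt_one {a b : ℂ} (ha : ‖a‖ < 1) (hb : ‖b‖ < 1) :
    ‖(a - b) / (1 - (starRingEnd ℂ) a * b)‖ < 1 := by
  have h := norm_mobius_lt_one (a := -a) (z := b) (by simpa) hb
  rw [mobius, map_neg, neg_mul, ← sub_eq_add_neg, ← sub_eq_add_neg] at h
  rwa [norm_div, norm_sub_rev, ← norm_div]

theorem Real.hasDerivAt_tanh (t : ℝ) : HasDerivAt Real.tanh (1 - Real.tanh t ^ 2) t := by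
  have h := (Real.hasDerivAt_sinh t).div (Real.hasDerivAt_cosh t) (Real.cosh_pos t).ne'
  have h2 : Real.tanh = Real.sinh / Real.cosh := by
    ext s; exact Real.tanh_eq_sinh_div_cosh s
  rw [h2]
  convert! h using 1
  have := (Real.cosh_pos t).ne'
  simp only [Pi.div_apply]
  field_simp

theorem Real.contDiff_tanh : ContDiff ℝ 1 Real.tanh := by
  have h2 : Real.tanh = fun s => Real.sinh s / Real.cosh s := by
    ext s; exact Real.tanh_eq_sinh_div_cosh s
  rw [h2]
  exact Real.contDiff_sinh.div Real.contDiff_cosh fun t => (Real.cosh_pos t).ne'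

theorem norm_ofReal_tanh_lt_one (t : ℝ) : ‖(Real.tanh t : ℂ)‖ < 1 := by
  rw [Complex.norm_real]; exact Real.abs_tanh_lt_one t

/-- By the subtraction formula, `tanh` parametrises the real diameter of the disc by Poincaré arc
length. This is the source of the unit-speed curves below. -/
theorem poincareDist_tanh (s t : ℝ) :
    poincareDist (Real.tanh s : ℂ) (Real.tanh t : ℂ) = |s - t| := by
  have h : (Real.tanh s - Real.tanh t) / (1 - Real.tanh s * Real.tanh t) = Real.tanh (s - t) := by
    have h1 := (Real.cosh_pos s).ne'
    have h2 := (Real.cosh_pos t).ne'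
    have h3 : Real.cosh s * Real.cosh t - Real.sinh s * Real.sinh t ≠ 0 := by
      rw [← Real.cosh_sub]; exact (Real.cosh_pos _).ne'
    rw [Real.tanh_eq_sinh_div_cosh, Real.tanh_eq_sinh_div_cosh, Real.tanh_eq_sinh_div_cosh,
      Real.sinh_sub, Real.cosh_sub]
    have h4 : 1 - Real.sinh s / Real.cosh s * (Real.sinh t / Real.cosh t) =
        (Real.cosh s * Real.cosh t - Real.sinh s * Real.sinh t) / (Real.cosh s * Real.cosh t) := by
      field_simp
    rw [h4]
    field_simp
  have h5 : ‖((Real.tanh s : ℂ) - Real.tanh t) / (1 - (starRingEnd ℂ) (Real.tanh s : ℂ) *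
      (Real.tanh t : ℂ))‖ = |Real.tanh (s - t)| := by
    rw [Complex.conj_ofReal, ← h, ← Real.norm_eq_abs, ← Complex.norm_real]
    push_cast
    rfl
  unfold poincareDist
  rw [h5]
  rcases le_total 0 (s - t) with h6 | h6
  · rw [abs_of_nonneg h6, abs_of_nonneg, Real.artanh_tanh]
    rw [Real.tanh_eq_sinh_div_cosh]
    exact div_nonneg (Real.sinh_nonneg_iff.2 h6) (Real.cosh_pos _).le
  · rw [abs_of_nonpos h6, abs_of_nonpos, ← Real.tanh_neg, Real.artanh_tanh]
    rw [Real.tanh_eq_sinh_div_cosh]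
    exact div_nonpos_of_nonpos_of_nonneg (Real.sinh_nonpos_iff.2 h6) (Real.cosh_pos _).le

/-! ### Chains of analytic discs and the Kobayashi pseudo-distance -/

theorem IsAnalyticDisc.comp {f : ℂ → CSpace d} (hf : IsAnalyticDisc Ω f) {g : ℂ → ℂ}
    (hg : DifferentiableOn ℂ g (Metric.ball 0 1))
    (hm : MapsTo g (Metric.ball 0 1) (Metric.ball 0 1)) : IsAnalyticDisc Ω (f ∘ g) :=
  ⟨hf.1.comp hg hm, hf.2.comp hm⟩

namespace KobayashiChain

theorem nonneg {z w : CSpace d} {L : ℝ} (h : KobayashiChain Ω z w L) : 0 ≤ L := by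
  induction h with
  | nil => exact le_rfl
  | cons f hf a b ha hb w L h ih => exact add_nonneg (poincareDist_nonneg a b) ih

theorem disc {f : ℂ → CSpace d} (hf : IsAnalyticDisc Ω f) {a b : ℂ}
    (ha : a ∈ Metric.ball (0 : ℂ) 1) (hb : b ∈ Metric.ball (0 : ℂ) 1) :
    KobayashiChain Ω (f a) (f b) (poincareDist a b) := by
  simpa using KobayashiChain.cons f hf a b ha hb _ _ (KobayashiChain.nil (f b) (hf.2 hb))

theorem trans {u v w : CSpace d} {L M : ℝ} (h : KobayashiChain Ω u v L)
    (h' : KobayashiChain Ω v w M) : KobayashiChain Ω u w (L + M) := by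
  induction h with
  | nil => simpa using h'
  | cons f hf a b ha hb v L h ih =>
    rw [add_assoc]
    exact KobayashiChain.cons f hf a b ha hb _ _ (ih h')

theorem symm {z w : CSpace d} {L : ℝ} (h : KobayashiChain Ω z w L) : KobayashiChain Ω w z L := by
  induction h with
  | nil z hz => exact KobayashiChain.nil z hz
  | cons f hf a b ha hb w L h ih =>
    have := ih.trans (KobayashiChain.disc hf hb ha)
    rwa [add_comm, poincareDist_comm] at this

theorem exists_of_ball {z w : CSpace d} {ε : ℝ} (hε : Metric.ball z ε ⊆ Ω)
    (hw : w ∈ Metric.ball z (ε / 2)) : ∃ L, KobayashiChain Ω z w L := by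
  -- The factor 2 places `w` at the interior parameter `1/2`; the image stays in the ball because
  -- `‖w - z‖ < ε / 2`.
  have hf : IsAnalyticDisc Ω (fun ζ : ℂ => z + (2 * ζ) • (w - z)) := by
    refine ⟨by fun_prop, fun ζ hζ => hε ?_⟩
    rw [mem_ball_zero_iff] at hζ
    rw [Metric.mem_ball, dist_eq_norm] at hw ⊢
    rw [add_sub_cancel_left, norm_smul, norm_mul, Complex.norm_ofNat]
    nlinarith [norm_nonneg ζ, norm_nonneg (w - z)]
  have h := KobayashiChain.disc hf (a := 0) (b := 1 / 2) (by simp) (by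
    rw [mem_ball_zero_iff]; norm_num)
  exact ⟨_, by simpa using h⟩

/-- Chain-connectedness is an equivalence relation that holds locally, so a connected `Ω` is a
single class. This keeps the infimum in `kobayashiDist` from being taken over the empty set. -/
theorem exists_of_isConnected (ho : IsOpen Ω) (hc : IsConnected Ω) {z w : CSpace d} (hz : z ∈ Ω)
    (hw : w ∈ Ω) : ∃ L, KobayashiChain Ω z w L := by
  refine hc.isPreconnected.induction₂ (fun z w => ∃ L, KobayashiChain Ω z w L) ?_ ?_ ?_ hz hw
  · intro x hx
    obtain ⟨ε, hε, h⟩ := Metric.isOpen_iff.1 ho x hx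
    exact mem_nhdsWithin_of_mem_nhds
      (mem_of_superset (Metric.ball_mem_nhds x (half_pos hε)) fun y hy => exists_of_ball h hy)
  · rintro x y u hx hy hu ⟨L, h⟩ ⟨M, h'⟩
    exact ⟨_, h.trans h'⟩
  · rintro x y hx hy ⟨L, h⟩
    exact ⟨_, h.symm⟩

end KobayashiChain

theorem kobayashiDist_comm (z w : CSpace d) : kobayashiDist Ω z w = kobayashiDist Ω w z := by
  unfold kobayashiDist
  congr 1
  ext L
  exact ⟨KobayashiChain.symm, KobayashiChain.symm⟩

theorem KobayashiChain.kobayashiDist_le {z w : CSpace d} {L : ℝ} (h : KobayashiChain Ω z w L) :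
    kobayashiDist Ω z w ≤ L :=
  csInf_le ⟨0, fun _ hL => KobayashiChain.nonneg hL⟩ h

theorem kobayashiDist_triangle (ho : IsOpen Ω) (hc : IsConnected Ω) {u v w : CSpace d}
    (hu : u ∈ Ω) (hv : v ∈ Ω) (hw : w ∈ Ω) :
    kobayashiDist Ω u w ≤ kobayashiDist Ω u v + kobayashiDist Ω v w := by
  refine le_of_forall_pos_lt_add fun ε hε => ?_
  obtain ⟨L, hL, hL'⟩ := exists_lt_of_csInf_lt
    (KobayashiChain.exists_of_isConnected ho hc hu hv)
    (show kobayashiDist Ω u v < kobayashiDist Ω u v + ε / 2 by linarith)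
  obtain ⟨M, hM, hM'⟩ := exists_lt_of_csInf_lt
    (KobayashiChain.exists_of_isConnected ho hc hv hw)
    (show kobayashiDist Ω v w < kobayashiDist Ω v w + ε / 2 by linarith)
  have := (KobayashiChain.trans hL hM).kobayashiDist_le
  linarith

/-! ### The infinitesimal Kobayashi pseudo-metric -/

theorem kobayashiMetric_le {f : ℂ → CSpace d} (hf : IsAnalyticDisc Ω f) (ζ : ℂ) :
    kobayashiMetric Ω (f 0) (ζ • deriv f 0) ≤ ‖ζ‖ := by
  refine csInf_le ⟨0, ?_⟩ ⟨f, ζ, hf, rfl, rfl, rfl⟩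
  rintro _ ⟨f, ζ, -, -, -, rfl⟩
  exact norm_nonneg _

theorem kobayashiMetric_set_nonempty (ho : IsOpen Ω) {z : CSpace d} (hz : z ∈ Ω) (v : CSpace d) :
    {r : ℝ | ∃ (f : ℂ → CSpace d) (ζ : ℂ),
      IsAnalyticDisc Ω f ∧ f 0 = z ∧ ζ • deriv f 0 = v ∧ r = ‖ζ‖}.Nonempty := by
  obtain ⟨ε, hε, h⟩ := Metric.isOpen_iff.1 ho z hz
  -- The `+ 1` also covers `v = 0`.
  have hc : 0 < ε / (‖v‖ + 1) := by positivity
  refine ⟨_, fun ζ : ℂ => z + ζ • (((ε / (‖v‖ + 1) : ℝ) : ℂ) • v),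
    (((ε / (‖v‖ + 1) : ℝ) : ℂ))⁻¹, ⟨by fun_prop, fun ζ hζ => h ?_⟩, by simp, ?_, rfl⟩
  · rw [mem_ball_zero_iff] at hζ
    rw [Metric.mem_ball, dist_eq_norm, add_sub_cancel_left, norm_smul, norm_smul,
      Complex.norm_real, Real.norm_of_nonneg hc.le]
    have h1 : ε / (‖v‖ + 1) * ‖v‖ < ε := by
      rw [div_mul_eq_mul_div, div_lt_iff₀ (by positivity)]
      nlinarith
    have h2 : 0 ≤ ε / (‖v‖ + 1) * ‖v‖ := by positivity
    nlinarith [norm_nonneg ζ]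
  · have h1 : HasDerivAt (fun ζ : ℂ => z + ζ • (((ε / (‖v‖ + 1) : ℝ) : ℂ) • v))
        ((1 : ℂ) • (((ε / (‖v‖ + 1) : ℝ) : ℂ) • v)) 0 :=
      ((hasDerivAt_id (0 : ℂ)).smul_const _).const_add z
    rw [h1.deriv, one_smul, smul_smul, inv_mul_cancel₀, one_smul]
    exact_mod_cast hc.ne'

/-- Rescaling `ζ` turns a competitor for `v` into one for the unit vector. Only this half of
homogeneity is needed, to pass from the unit vectors in `goldilocksM` to velocities. -/
theorem norm_mul_kobayashiMetric_le (ho : IsOpen Ω) {z : CSpace d} (hz : z ∈ Ω) {v : CSpace d}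
    (hv : v ≠ 0) :
    ‖v‖ * kobayashiMetric Ω z (((‖v‖⁻¹ : ℝ) : ℂ) • v) ≤ kobayashiMetric Ω z v := by
  have hn : 0 < ‖v‖ := norm_pos_iff.2 hv
  refine le_csInf (kobayashiMetric_set_nonempty ho hz v) ?_
  rintro _ ⟨f, ζ, hf, rfl, rfl, rfl⟩
  have h := kobayashiMetric_le hf (((‖ζ • deriv f 0‖⁻¹ : ℝ) : ℂ) * ζ)
  rw [mul_smul, norm_mul, Complex.norm_real, Real.norm_of_nonneg (by positivity)] at h
  calc _ ≤ ‖ζ • deriv f 0‖ * (‖ζ • deriv f 0‖⁻¹ * ‖ζ‖) := by gcongr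
    _ = ‖ζ‖ := by field_simp

/-- Precomposing with `mobius c` recentres the disc at `c` and multiplies the derivative by `1 - ‖c‖
^ 2`. -/
theorem kobayashiMetric_le_of_disc {f : ℂ → CSpace d} (hf : IsAnalyticDisc Ω f) {c : ℂ}
    (hc : ‖c‖ < 1) (ζ : ℂ) :
    kobayashiMetric Ω (f c) (ζ • deriv f c) ≤ ‖ζ‖ / (1 - ‖c‖ ^ 2) := by
  have hm : MapsTo (mobius c) (Metric.ball 0 1) (Metric.ball 0 1) := fun w hw => by
    rw [mem_ball_zero_iff] at hw ⊢
    exact norm_mobius_lt_one hc hw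
  have hg : IsAnalyticDisc Ω (f ∘ mobius c) := hf.comp (fun w hw =>
    (hasDerivAt_mobius hc (mem_ball_zero_iff.1 hw)).differentiableAt.differentiableWithinAt) hm
  have hpos : 0 < 1 - ‖c‖ ^ 2 := by nlinarith [norm_nonneg c]
  have h1 : HasDerivAt (mobius c) ((1 - ‖c‖ ^ 2 : ℝ) : ℂ) 0 := by
    simpa using hasDerivAt_mobius hc (z := 0) (by simp)
  have h2 : HasDerivAt f (deriv f c) (mobius c 0) := by
    rw [mobius_zero]
    exact (hf.1.differentiableAt (Metric.isOpen_ball.mem_nhds (by simpa using hc))).hasDerivAt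
  have h3 := (HasDerivAt.scomp (0 : ℂ) h2 h1).deriv
  have h4 := kobayashiMetric_le hg (ζ * ((1 - ‖c‖ ^ 2 : ℝ) : ℂ)⁻¹)
  rw [h3, smul_smul, mul_assoc, inv_mul_cancel₀ (by exact_mod_cast hpos.ne'), mul_one,
    Function.comp_apply, mobius_zero, norm_mul, norm_inv, Complex.norm_real,
    Real.norm_of_nonneg hpos.le] at h4
  exact h4

/-! ### Curves of unit Kobayashi speed and the existence of almost-geodesics -/

/-- `σ : [0, L] → Ω` is a Lipschitz curve of Kobayashi speed at most `1`. -/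
structure IsKobayashiPath (Ω : Set (CSpace d)) (L : ℝ) (σ : ℝ → CSpace d) : Prop where
  nonneg : 0 ≤ L
  mem : ∀ t ∈ Icc 0 L, σ t ∈ Ω
  dist_le : ∀ s ∈ Icc 0 L, ∀ t ∈ Icc 0 L, kobayashiDist Ω (σ s) (σ t) ≤ |s - t|
  lipschitz : ∃ C, LipschitzOnWith C σ (Icc 0 L)
  speed : ∀ᵐ t, t ∈ Icc 0 L → kobayashiMetric Ω (σ t) (deriv σ t) ≤ 1

/-- The derivative `1 - tanh²` cancels the denominator in `kobayashiMetric_le_of_disc`, which leaves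
speed at most 1. -/
theorem IsAnalyticDisc.isKobayashiPath {f : ℂ → CSpace d} (hf : IsAnalyticDisc Ω f) {L : ℝ}
    (hL : 0 ≤ L) : IsKobayashiPath Ω L fun t => f (Real.tanh t : ℂ) := by
  have hb : ∀ t : ℝ, (Real.tanh t : ℂ) ∈ Metric.ball (0 : ℂ) 1 := fun t => by
    rw [mem_ball_zero_iff]; exact norm_ofReal_tanh_lt_one t
  refine ⟨hL, fun t _ => hf.2 (hb t), fun s _ t _ => ?_, ?_, Eventually.of_forall fun t _ => ?_⟩
  · rw [← poincareDist_tanh]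
    exact (KobayashiChain.disc hf (hb s) (hb t)).kobayashiDist_le
  · have h1 : ContDiffOn ℝ 1 f (Metric.ball 0 1) :=
      (hf.1.contDiffOn Metric.isOpen_ball).restrict_scalars ℝ
    have h2 : ContDiff ℝ 1 fun t : ℝ => (Real.tanh t : ℂ) :=
      Complex.ofRealCLM.contDiff.comp Real.contDiff_tanh
    have h3 : ContDiffOn ℝ 1 (fun t : ℝ => f (Real.tanh t : ℂ)) (Icc 0 L) :=
      h1.comp h2.contDiffOn fun t _ => hb t
    exact h3.exists_lipschitzOnWith (by decide) (convex_Icc _ _) isCompact_Icc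
  · have h1 : HasDerivAt f (deriv f (Real.tanh t : ℂ)) (Real.tanh t : ℂ) :=
      (hf.1.differentiableAt (Metric.isOpen_ball.mem_nhds (hb t))).hasDerivAt
    have h2 : HasDerivAt (fun t : ℝ => (Real.tanh t : ℂ)) ((1 - Real.tanh t ^ 2 : ℝ) : ℂ) t :=
      (Real.hasDerivAt_tanh t).ofReal_comp
    have h3 : HasDerivAt (fun t : ℝ => f (Real.tanh t : ℂ))
        (((1 - Real.tanh t ^ 2 : ℝ) : ℂ) • deriv f (Real.tanh t : ℂ)) t :=
      HasDerivAt.scomp t h1 h2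
    rw [h3.deriv]
    have hpos : 0 < 1 - Real.tanh t ^ 2 := by linarith [Real.tanh_sq_lt_one t]
    refine (kobayashiMetric_le_of_disc hf (norm_ofReal_tanh_lt_one t) _).trans ?_
    rw [Complex.norm_real, Complex.norm_real, Real.norm_of_nonneg hpos.le, Real.norm_eq_abs,
      sq_abs, div_self hpos.ne']

/-- A rotation followed by `mobius a` moves the two parameters onto the diameter parametrised by
`tanh`. -/
theorem IsAnalyticDisc.exists_normalized {f : ℂ → CSpace d} (hf : IsAnalyticDisc Ω f) {a b : ℂ}
    (ha : ‖a‖ < 1) (hb : ‖b‖ < 1) :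
    ∃ g, IsAnalyticDisc Ω g ∧ g 0 = f a ∧ g (Real.tanh (poincareDist a b) : ℂ) = f b := by
  set w := (b - a) / (1 - (starRingEnd ℂ) a * b) with hw
  have hn : ‖(a - b) / (1 - (starRingEnd ℂ) a * b)‖ = ‖w‖ := by
    rw [hw, norm_div, norm_div, norm_sub_rev]
  have ht : Real.tanh (poincareDist a b) = ‖w‖ := by
    rw [poincareDist, hn, Real.tanh_artanh]
    exact ⟨by linarith [norm_nonneg w], by rw [← hn]; exact norm_mobius_inv_lt_one ha hb⟩
  set u := Complex.exp (w.arg * Complex.I) with hu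
  have hu1 : ‖u‖ = 1 := by rw [hu, Complex.norm_exp_ofReal_mul_I]
  have hball : ∀ z ∈ Metric.ball (0 : ℂ) 1, ‖u * z‖ < 1 := fun z hz => by
    rw [norm_mul, hu1, one_mul]; exact mem_ball_zero_iff.1 hz
  refine ⟨f ∘ fun z => mobius a (u * z), hf.comp (fun z hz => ?_) (fun z hz => ?_), ?_, ?_⟩
  · have h1 : DifferentiableAt ℂ (fun z : ℂ => u * z) z := by fun_prop
    exact (DifferentiableAt.comp z (hasDerivAt_mobius ha (hball z hz)).differentiableAt
      h1).differentiableWithinAt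
  · rw [mem_ball_zero_iff]; exact norm_mobius_lt_one ha (hball z hz)
  · simp [mobius_zero]
  · rw [ht, Function.comp_apply, mul_comm, hu, Complex.norm_mul_exp_arg_mul_I, hw,
      mobius_right_inv ha hb]

theorem IsKobayashiPath.concat (ho : IsOpen Ω) (hc : IsConnected Ω) {L M : ℝ}
    {σ τ : ℝ → CSpace d} (hσ : IsKobayashiPath Ω L σ) (hτ : IsKobayashiPath Ω M τ)
    (h : σ L = τ 0) :
    IsKobayashiPath Ω (L + M) fun t => if t ≤ L then σ t else τ (t - L) := by
  set ρ : ℝ → CSpace d := fun t => if t ≤ L then σ t else τ (t - L) with hρ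
  have hl : ∀ t, t ≤ L → ρ t = σ t := fun t ht => by simp [hρ, ht]
  have hr : ∀ t, L ≤ t → ρ t = τ (t - L) := fun t ht => by
    rcases ht.eq_or_lt with rfl | ht
    · simp [hρ, h]
    · simp [hρ, not_le.2 ht]
  have hL := hσ.nonneg
  have hM := hτ.nonneg
  have hLmem : L ∈ Icc 0 L := ⟨hL, le_rfl⟩
  have h0mem : (0 : ℝ) ∈ Icc 0 M := ⟨le_rfl, hM⟩
  have hmem : ∀ t ∈ Icc 0 (L + M), ρ t ∈ Ω := fun t ht => by
    rcases le_total t L with h1 | h1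
    · rw [hl t h1]; exact hσ.mem t ⟨ht.1, h1⟩
    · rw [hr t h1]; exact hτ.mem _ ⟨by linarith, by linarith [ht.2]⟩
  refine ⟨by linarith, hmem, ?_, ?_, ?_⟩
  · have key : ∀ s ∈ Icc 0 (L + M), ∀ t ∈ Icc 0 (L + M), s ≤ t →
        kobayashiDist Ω (ρ s) (ρ t) ≤ |s - t| := by
      intro s hs t ht hst
      rcases le_total t L with h1 | h1
      · rw [hl t h1, hl s (hst.trans h1)]
        exact hσ.dist_le s ⟨hs.1, hst.trans h1⟩ t ⟨ht.1, h1⟩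
      have htM : t - L ∈ Icc 0 M := ⟨by linarith, by linarith [ht.2]⟩
      rcases le_total L s with h2 | h2
      · rw [hr t h1, hr s h2]
        refine (hτ.dist_le _ ⟨by linarith, by linarith [hs.2]⟩ _ htM).trans_eq ?_
        congr 1; ring
      · have hsL : s ∈ Icc 0 L := ⟨hs.1, h2⟩
        have e1 := hσ.dist_le s hsL L hLmem
        have e2 := hτ.dist_le 0 h0mem (t - L) htM
        rw [hl s h2, hr t h1]
        refine (kobayashiDist_triangle ho hc (hσ.mem s hsL) (hσ.mem L hLmem)
          (hτ.mem _ htM)).trans ?_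
        rw [h] at e1 ⊢
        rw [abs_of_nonpos (by linarith)] at e1 e2 ⊢
        linarith
    intro s hs t ht
    rcases le_total s t with hst | hst
    · exact key s hs t ht hst
    · rw [kobayashiDist_comm, abs_sub_comm]; exact key t ht s hs hst
  · obtain ⟨C, hC⟩ := hσ.lipschitz
    obtain ⟨D, hD⟩ := hτ.lipschitz
    refine ⟨C + D, LipschitzOnWith.of_dist_le_mul ?_⟩
    have key : ∀ s ∈ Icc 0 (L + M), ∀ t ∈ Icc 0 (L + M), s ≤ t →
        dist (ρ s) (ρ t) ≤ ((C + D : NNReal) : ℝ) * dist s t := by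
      intro s hs t ht hst
      have hC0 := C.coe_nonneg
      have hD0 := D.coe_nonneg
      rw [NNReal.coe_add, dist_comm s t, Real.dist_eq, abs_of_nonneg (by linarith)]
      rcases le_total t L with h1 | h1
      · rw [hl t h1, hl s (hst.trans h1)]
        refine (hC.dist_le_mul s ⟨hs.1, hst.trans h1⟩ t ⟨ht.1, h1⟩).trans ?_
        rw [dist_comm, Real.dist_eq, abs_of_nonneg (by linarith)]
        nlinarith
      have htM : t - L ∈ Icc 0 M := ⟨by linarith, by linarith [ht.2]⟩
      rcases le_total L s with h2 | h2
      · rw [hr t h1, hr s h2]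
        refine (hD.dist_le_mul _ ⟨by linarith, by linarith [hs.2]⟩ _ htM).trans ?_
        rw [dist_comm, Real.dist_eq, abs_of_nonneg (by linarith)]
        nlinarith
      · have hsL : s ∈ Icc 0 L := ⟨hs.1, h2⟩
        have e1 := hC.dist_le_mul s hsL L hLmem
        have e2 := hD.dist_le_mul 0 h0mem (t - L) htM
        rw [hl s h2, hr t h1]
        refine (dist_triangle _ (σ L) _).trans ?_
        nth_rewrite 2 [h]
        rw [dist_comm s, Real.dist_eq, abs_of_nonneg (by linarith)] at e1
        rw [dist_comm 0, Real.dist_eq, abs_of_nonneg (by linarith)] at e2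
        nlinarith
    intro s hs t ht
    rcases le_total s t with hst | hst
    · exact key s hs t ht hst
    · rw [dist_comm, dist_comm s]; exact key t ht s hs hst
  · have e2 : ∀ᵐ t : ℝ, t - L ∈ Icc 0 M →
        kobayashiMetric Ω (τ (t - L)) (deriv τ (t - L)) ≤ 1 :=
      (measurePreserving_sub_right volume L).quasiMeasurePreserving.ae hτ.speed
    -- The curve may have a corner at the junction, which is a null set.
    have e3 : ∀ᵐ t : ℝ, t ≠ L := by
      simp [ae_iff, measure_singleton]
    filter_upwards [hσ.speed, e2, e3] with t h1 h2 h3 ht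
    rcases lt_or_gt_of_ne h3 with h4 | h4
    · have : ρ =ᶠ[𝓝 t] σ := by
        filter_upwards [Iio_mem_nhds h4] with s hs using hl s (le_of_lt hs)
      rw [this.deriv_eq, hl t h4.le]
      exact h1 ⟨ht.1, h4.le⟩
    · have : ρ =ᶠ[𝓝 t] fun s => τ (s - L) := by
        filter_upwards [Ioi_mem_nhds h4] with s hs using hr s (le_of_lt hs)
      rw [this.deriv_eq, hr t h4.le, deriv_comp_sub_const]
      exact h2 ⟨by linarith, by linarith [ht.2]⟩

theorem KobayashiChain.exists_path (ho : IsOpen Ω) (hc : IsConnected Ω) {z w : CSpace d} {L : ℝ}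
    (h : KobayashiChain Ω z w L) : ∃ σ, IsKobayashiPath Ω L σ ∧ σ 0 = z ∧ σ L = w := by
  induction h with
  | nil z hz =>
    refine ⟨fun t => z, ?_, rfl, rfl⟩
    have hf : IsAnalyticDisc Ω fun _ : ℂ => z := ⟨by fun_prop, fun _ _ => hz⟩
    exact hf.isKobayashiPath le_rfl
  | cons f hf a b ha hb w L h ih =>
    obtain ⟨τ, hτ, hτ0, hτL⟩ := ih
    obtain ⟨g, hg, hg0, hgb⟩ := hf.exists_normalized (mem_ball_zero_iff.1 ha)
      (mem_ball_zero_iff.1 hb)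
    have hp := hg.isKobayashiPath (poincareDist_nonneg a b)
    refine ⟨_, hp.concat ho hc hτ (by rw [hgb, hτ0]), ?_, ?_⟩
    · simp [poincareDist_nonneg, hg0]
    · rcases (hτ.nonneg).eq_or_lt with h0 | h0
      · subst h0
        simp only [add_zero, le_refl, if_true]
        rw [hgb, ← hτL, hτ0]
      · simp [h0, hτL]

/-- A chain whose length exceeds the distance by less than 1 yields such a path. By the triangle
inequality no subarc has a larger excess, hence `κ = 1`. -/
theorem exists_isAlmostGeodesic (ho : IsOpen Ω) (hc : IsConnected Ω) {z w : CSpace d}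
    (hz : z ∈ Ω) (hw : w ∈ Ω) :
    ∃ (L : ℝ) (σ : ℝ → CSpace d), 0 ≤ L ∧ IsAlmostGeodesic Ω 1 1 0 L σ ∧ σ 0 = z ∧ σ L = w := by
  obtain ⟨L, hL, hL'⟩ := exists_lt_of_csInf_lt
    (KobayashiChain.exists_of_isConnected ho hc hz hw)
    (show kobayashiDist Ω z w < kobayashiDist Ω z w + 1 by linarith)
  obtain ⟨σ, hσ, h0, h1⟩ := KobayashiChain.exists_path ho hc hL
  have hL0 := hσ.nonneg
  have m0 : (0 : ℝ) ∈ Icc 0 L := ⟨le_rfl, hL0⟩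
  have mL : L ∈ Icc 0 L := ⟨hL0, le_rfl⟩
  refine ⟨L, σ, hL0, ⟨hσ.mem, ?_, ?_, ?_, ?_⟩, h0, h1⟩
  · have key : ∀ s ∈ Icc 0 L, ∀ t ∈ Icc 0 L, s ≤ t →
        t - s - 1 ≤ kobayashiDist Ω (σ s) (σ t) := by
      intro s hs t ht hst
      have e1 := kobayashiDist_triangle ho hc (hσ.mem 0 m0) (hσ.mem s hs) (hσ.mem L mL)
      have e2 := kobayashiDist_triangle ho hc (hσ.mem s hs) (hσ.mem t ht) (hσ.mem L mL)
      have e3 := hσ.dist_le 0 m0 s hs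
      have e4 := hσ.dist_le t ht L mL
      rw [abs_of_nonpos (by linarith [hs.1])] at e3
      rw [abs_of_nonpos (by linarith [ht.2])] at e4
      rw [h0, h1] at e1
      rw [h0] at e3
      rw [h1] at e2 e4
      linarith
    intro s hs t ht
    rcases le_total s t with hst | hst
    · rw [kobayashiDist_comm, abs_of_nonneg (by linarith), inv_one, one_mul]
      exact key s hs t ht hst
    · rw [abs_of_nonpos (by linarith), inv_one, one_mul, neg_sub]
      exact key t ht s hs hst
  · intro s hs t ht
    have := hσ.dist_le t ht s hs
    linarith
  · obtain ⟨C, hC⟩ := hσ.lipschitz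
    rw [← uIcc_of_le hL0] at hC
    exact hC.absolutelyContinuousOnInterval
  · exact (ae_restrict_iff' measurableSet_Icc).2 hσ.speed

theorem IsAlmostGeodesic.mono {lam κ a b a' b' : ℝ} {σ : ℝ → CSpace d}
    (h : IsAlmostGeodesic Ω lam κ a b σ) (ha : a ≤ a') (hab : a' ≤ b') (hb : b' ≤ b) :
    IsAlmostGeodesic Ω lam κ a' b' σ := by
  have hs : Icc a' b' ⊆ Icc a b := Icc_subset_Icc ha hb
  refine ⟨fun t ht => h.mem t (hs ht), fun s hs' t ht => h.lower s (hs hs') t (hs ht),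
    fun s hs' t ht => h.upper s (hs hs') t (hs ht), h.absolutelyContinuous.mono ?_,
    ae_restrict_of_ae_restrict_of_subset hs h.speed⟩
  rw [uIcc_of_le hab, uIcc_of_le (ha.trans (hab.trans hb))]
  exact hs

theorem IsAlmostGeodesic.continuousOn {lam κ a b : ℝ} {σ : ℝ → CSpace d}
    (h : IsAlmostGeodesic Ω lam κ a b σ) (hab : a ≤ b) : ContinuousOn σ (Icc a b) := by
  have := h.absolutelyContinuous.continuousOn
  rwa [uIcc_of_le hab] at this

/-! ### Absolutely continuous curves -/

theorem LipschitzWith.comp_absolutelyContinuousOnInterval {E F : Type*} [PseudoMetricSpace E]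
    [PseudoMetricSpace F] {f : E → F} {K : NNReal} (hf : LipschitzWith K f) {σ : ℝ → E} {a b : ℝ}
    (hσ : AbsolutelyContinuousOnInterval σ a b) : AbsolutelyContinuousOnInterval (f ∘ σ) a b := by
  have h := Tendsto.const_mul (K : ℝ) hσ
  rw [mul_zero] at h
  refine squeeze_zero (fun _ => Finset.sum_nonneg fun _ _ => dist_nonneg) (fun E => ?_) h
  rw [Finset.mul_sum]
  exact Finset.sum_le_sum fun i _ => hf.dist_le_mul _ _

/-- A functional of norm at most 1 that norms `σ b - σ a` reduces this to the fundamental theorem of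
calculus for real absolutely continuous functions. -/
theorem AbsolutelyContinuousOnInterval.enorm_sub_le_lintegral {E : Type*} [NormedAddCommGroup E]
    [NormedSpace ℝ E] [FiniteDimensional ℝ E] {σ : ℝ → E} {a b : ℝ} (hab : a ≤ b)
    (hσ : AbsolutelyContinuousOnInterval σ a b) :
    ‖σ b - σ a‖ₑ ≤ ∫⁻ t in Icc a b, ‖deriv σ t‖ₑ := by
  obtain ⟨g, hg, hgv⟩ := exists_dual_vector'' ℝ (σ b - σ a)
  have hac : AbsolutelyContinuousOnInterval (fun t => g (σ t)) a b :=
    g.lipschitz.comp_absolutelyContinuousOnInterval hσ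
  have hd : ∀ᵐ t, t ∈ uIcc a b → DifferentiableAt ℝ σ t :=
    hσ.boundedVariationOn.ae_differentiableAt_of_mem_uIcc
  have h1 : (∫ t in a..b, deriv (fun t => g (σ t)) t) = ‖σ b - σ a‖ := by
    rw [hac.integral_deriv_eq_sub, ← map_sub, hgv]; rfl
  calc ‖σ b - σ a‖ₑ = ‖(‖σ b - σ a‖ : ℝ)‖ₑ := by simp
    _ ≤ ∫⁻ t in Ioc a b, ‖deriv (fun t => g (σ t)) t‖ₑ := by
      rw [← h1, intervalIntegral.integral_of_le hab]
      exact enorm_integral_le_lintegral_enorm _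
    _ ≤ ∫⁻ t in Icc a b, ‖deriv (fun t => g (σ t)) t‖ₑ :=
      lintegral_mono_set Ioc_subset_Icc_self
    _ ≤ ∫⁻ t in Icc a b, ‖deriv σ t‖ₑ := by
      refine lintegral_mono_ae ((ae_restrict_iff' measurableSet_Icc).2 ?_)
      filter_upwards [hd] with t ht hmem
      rw [uIcc_of_le hab] at ht
      have h2 : HasDerivAt (fun t => g (σ t)) (g (deriv σ t)) t :=
        g.hasFDerivAt.comp_hasDerivAt t (ht hmem).hasDerivAt
      rw [h2.deriv, ← ofReal_norm, ← ofReal_norm]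
      exact ENNReal.ofReal_le_ofReal
        ((g.le_of_opNorm_le hg _).trans_eq (one_mul _))

/-! ### Integral estimates -/

theorem exists_setLIntegral_Ioo_lt {F : ℝ → ENNReal} {ε : ℝ} (hε : 0 < ε)
    (hF : ∫⁻ r in Ioo 0 ε, F r < ⊤) {η : ENNReal} (hη : η ≠ 0) :
    ∃ x, 0 < x ∧ x ≤ ε ∧ ∫⁻ r in Ioo 0 x, F r < η := by
  obtain ⟨δ, hδ, h⟩ := exists_pos_setLIntegral_lt_of_measure_lt hF.ne hη
  obtain ⟨c, hc, hcδ⟩ : ∃ c : ℝ, 0 < c ∧ ENNReal.ofReal c < δ := by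
    obtain ⟨q, hq, hq'⟩ := ENNReal.lt_iff_exists_nnreal_btwn.1 hδ
    refine ⟨q, ?_, by simpa using hq'⟩
    exact_mod_cast hq
  refine ⟨min c ε, lt_min hc hε, min_le_right _ _, ?_⟩
  have hs : Ioo 0 (min c ε) ⊆ Ioo 0 ε := Ioo_subset_Ioo_right (min_le_right _ _)
  have h1 := h (Ioo 0 (min c ε)) (by
    refine (Measure.restrict_apply_le _ _).trans_lt ?_
    rw [Real.volume_Ioo, sub_zero]
    exact (ENNReal.ofReal_le_ofReal (min_le_left _ _)).trans_lt hcδ)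
  rwa [Measure.restrict_restrict measurableSet_Ioo, inter_eq_left.2 hs] at h1

/-- On `(x/2, x)` the integrand is at least `M (x/2) / x`. Thus the integral condition makes `M`
finite and small near 0. -/
theorem Monotone.le_two_mul_setLIntegral {M : ℝ → ENNReal} (hM : Monotone M) {x : ℝ}
    (hx : 0 < x) : M (x / 2) ≤ 2 * ∫⁻ r in Ioo 0 x, (ENNReal.ofReal r)⁻¹ * M r := by
  have h1 : ∫⁻ _ in Ioo (x / 2) x, (ENNReal.ofReal x)⁻¹ * M (x / 2) ≤
      ∫⁻ r in Ioo 0 x, (ENNReal.ofReal r)⁻¹ * M r :=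
    (setLIntegral_mono' measurableSet_Ioo fun r hr =>
      mul_le_mul' (ENNReal.inv_le_inv.2 (ENNReal.ofReal_le_ofReal hr.2.le)) (hM hr.1.le)).trans
      (lintegral_mono_set (Ioo_subset_Ioo_left (by linarith)))
  rw [setLIntegral_const, Real.volume_Ioo] at h1
  have h2 : 2 * ((ENNReal.ofReal x)⁻¹ * M (x / 2) * ENNReal.ofReal (x - x / 2)) = M (x / 2) := by
    have h3 : 2 * ENNReal.ofReal (x - x / 2) = ENNReal.ofReal x := by
      rw [show (2 : ENNReal) = ENNReal.ofReal 2 by simp, ← ENNReal.ofReal_mul (by norm_num)]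
      congr 1; ring
    calc _ = (ENNReal.ofReal x)⁻¹ * (2 * ENNReal.ofReal (x - x / 2)) * M (x / 2) := by ring
      _ = _ := by
        rw [h3, ENNReal.inv_mul_cancel (by simpa using hx) ENNReal.ofReal_ne_top, one_mul]
  calc M (x / 2) = _ := h2.symm
    _ ≤ _ := by gcongr

/-- Substitute `r = A * exp (-B * t)`, for which `|dr| / r = B dt`. -/
theorem mul_setLIntegral_Ioi_exp_le (M : ℝ → ENNReal) {A B : ℝ} (hA : 0 < A) (hB : 0 < B)
    (T : ℝ) :
    ENNReal.ofReal B * ∫⁻ t in Ioi T, M (A * Real.exp (-B * t)) ≤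
      ∫⁻ r in Ioo 0 (A * Real.exp (-B * T)), (ENNReal.ofReal r)⁻¹ * M r := by
  set f : ℝ → ℝ := fun t => A * Real.exp (-B * t) with hf
  have hpos : ∀ t, 0 < f t := fun t => by positivity
  have hd : ∀ t, HasDerivAt f (-B * f t) t := fun t => by
    have h1 : HasDerivAt (fun t : ℝ => -B * t) (-B) t := by
      simpa using (hasDerivAt_id t).const_mul (-B)
    convert! (h1.exp.const_mul A) using 1
    simp only [hf]; ring
  have hanti : StrictAnti f := fun s t hst => by
    simp only [hf]
    have : -B * t < -B * s := by nlinarith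
    gcongr
  have himg : f '' Ioi T ⊆ Ioo 0 (f T) := by
    rintro _ ⟨t, ht, rfl⟩
    exact ⟨hpos t, hanti ht⟩
  refine le_trans ?_ (lintegral_mono_set himg)
  rw [lintegral_image_eq_lintegral_abs_deriv_mul measurableSet_Ioi
    (fun t _ => (hd t).hasDerivWithinAt) hanti.injective.injOn,
    ← lintegral_const_mul' _ _ ENNReal.ofReal_ne_top]
  refine lintegral_mono fun t => le_of_eq ?_
  have h1 : |-B * f t| = B * f t := by
    rw [abs_mul, abs_neg, abs_of_pos hB, abs_of_pos (hpos t)]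
  rw [h1, ENNReal.ofReal_mul hB.le, mul_assoc, ← mul_assoc (ENNReal.ofReal (f t)),
    ENNReal.mul_inv_cancel (by simpa using hpos t) ENNReal.ofReal_ne_top, one_mul]

/-- The tails `|t| > T` are small by the exponential substitution, for a `T` fixed before `m`. On
`[-T, T]` the integrand is at most `M m`, which is small for small `m`. -/
theorem Monotone.exists_lintegral_exp_le {M : ℝ → ENNReal} (hM : Monotone M) {ε : ℝ}
    (hε : 0 < ε) (hI : ∫⁻ r in Ioo 0 ε, (ENNReal.ofReal r)⁻¹ * M r < ⊤) {A B : ℝ} (hA : 0 < A)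
    (hB : 0 < B) {η : ENNReal} (hη : η ≠ 0) :
    ∃ m, 0 < m ∧ M m ≠ ⊤ ∧ ∫⁻ t : ℝ, M (min m (A * Real.exp (-B * |t|))) ≤ η := by
  have hquart : 2 * (η / 4) = η / 2 := by
    rw [ENNReal.div_eq_inv_mul, ENNReal.div_eq_inv_mul, ← mul_assoc]
    congr 1
    rw [show (4 : ENNReal) = 2 * 2 by norm_num, ENNReal.mul_inv (by simp) (by simp),
      ← mul_assoc, ENNReal.mul_inv_cancel (by simp) (by simp), one_mul]
  have hη4 : η / 4 ≠ 0 := by simp [hη]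
  obtain ⟨x, hx, -, hxI⟩ := exists_setLIntegral_Ioo_lt hε hI
    (η := ENNReal.ofReal B * (η / 4)) (by simp [hη, hB])
  obtain ⟨T, hT, hTx⟩ : ∃ T : ℝ, 0 ≤ T ∧ A * Real.exp (-B * T) ≤ x := by
    refine ⟨max 0 (Real.log (A / x) / B), le_max_left _ _, ?_⟩
    have h1 : Real.log (A / x) ≤ B * max 0 (Real.log (A / x) / B) := by
      have := le_max_right 0 (Real.log (A / x) / B)
      rwa [div_le_iff₀' hB] at this
    have h2 : Real.exp (-B * max 0 (Real.log (A / x) / B)) ≤ x / A := by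
      rw [← Real.exp_log (show 0 < x / A by positivity)]
      refine Real.exp_le_exp.2 ?_
      rw [← inv_div A x, Real.log_inv]
      linarith
    rw [le_div_iff₀ hA] at h2
    linarith
  set c := ENNReal.ofReal (2 * T) with hc
  have hc1 : c + 1 ≠ ⊤ := ENNReal.add_ne_top.2 ⟨ENNReal.ofReal_ne_top, ENNReal.one_ne_top⟩
  -- The minimum with 1 keeps `M (y / 2)` finite even if `η = ⊤`; `c + 1` avoids division by zero
  -- when `T = 0`.
  obtain ⟨y, hy, hyε, hyI⟩ := exists_setLIntegral_Ioo_lt hε hI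
    (η := min 1 (η / 4 / (c + 1))) 
      (lt_min zero_lt_one (ENNReal.div_pos hη4 hc1)).ne'
  have hMy := hM.le_two_mul_setLIntegral hy
  have hMy' : M (y / 2) ≤ 2 * min 1 (η / 4 / (c + 1)) := hMy.trans (by gcongr)
  refine ⟨y / 2, by positivity, ?_, ?_⟩
  · refine ne_top_of_le_ne_top ?_ hMy'
    exact ENNReal.mul_ne_top (by simp) (ne_top_of_le_ne_top ENNReal.one_ne_top (min_le_left _ _))
  set h : ℝ → ENNReal := fun t => M (min (y / 2) (A * Real.exp (-B * |t|))) with hh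
  have hmeas : Measurable h := hM.measurable.comp (by fun_prop)
  have htail : ∫⁻ t in Ioi T, h t ≤ η / 4 := by
    have h1 : ENNReal.ofReal B * ∫⁻ t in Ioi T, h t ≤ ENNReal.ofReal B * (η / 4) := by
      refine le_trans ?_ hxI.le
      refine le_trans ?_ (lintegral_mono_set (Ioo_subset_Ioo_right hTx))
      refine le_trans ?_ (mul_setLIntegral_Ioi_exp_le M hA hB T)
      gcongr ENNReal.ofReal B * ?_
      refine setLIntegral_mono' measurableSet_Ioi fun t ht => hM ?_
      rw [abs_of_nonneg (hT.trans (le_of_lt ht))]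
      exact min_le_right _ _
    rwa [ENNReal.mul_le_mul_iff_right (by simpa using hB) ENNReal.ofReal_ne_top] at h1
  have htail' : ∫⁻ t in Iio (-T), h t ≤ η / 4 := by
    refine le_trans (le_of_eq ?_) htail
    have h1 := (Measure.measurePreserving_neg (volume : Measure ℝ)).setLIntegral_comp_preimage
      (measurableSet_Ioi (a := T)) hmeas
    rw [← h1]
    have h2 : (Neg.neg ⁻¹' Ioi T : Set ℝ) = Iio (-T) := by ext t; simp
    rw [h2]
    simp [hh]
  have hmid : ∫⁻ t in Icc (-T) T, h t ≤ η / 2 := by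
    calc ∫⁻ t in Icc (-T) T, h t ≤ ∫⁻ _ in Icc (-T) T, M (y / 2) :=
          lintegral_mono fun t => hM (min_le_left _ _)
      _ = M (y / 2) * c := by
          rw [setLIntegral_const, Real.volume_Icc, hc]; congr 2; ring
      _ ≤ 2 * (η / 4 / (c + 1)) * (c + 1) := by
          refine mul_le_mul' (hMy'.trans ?_) le_self_add
          gcongr
          exact min_le_right _ _
      _ = 2 * (η / 4) := by rw [mul_assoc, ENNReal.div_mul_cancel (by simp) hc1]
      _ = η / 2 := hquart
  have hcover : (univ : Set ℝ) ⊆ Icc (-T) T ∪ (Ioi T ∪ Iio (-T)) := fun t _ => by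
    by_cases h1 : T < t
    · exact Or.inr (Or.inl h1)
    by_cases h2 : t < -T
    · exact Or.inr (Or.inr h2)
    exact Or.inl ⟨not_lt.1 h2, not_lt.1 h1⟩
  calc ∫⁻ t, h t = ∫⁻ t in univ, h t := by simp
    _ ≤ ∫⁻ t in Icc (-T) T ∪ (Ioi T ∪ Iio (-T)), h t := lintegral_mono_set hcover
    _ ≤ (∫⁻ t in Icc (-T) T, h t) + ((∫⁻ t in Ioi T, h t) + ∫⁻ t in Iio (-T), h t) :=
        (lintegral_union_le _ _ _).trans (add_le_add le_rfl (lintegral_union_le _ _ _))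
    _ ≤ η / 2 + (η / 4 + η / 4) := by gcongr
    _ = η := by rw [← two_mul, hquart, ENNReal.add_halves]

/-! ### Almost-geodesics near local Goldilocks points -/

theorem goldilocksM_mono (Ω U : Set (CSpace d)) : Monotone (goldilocksM Ω U) := fun r s hrs => by
  refine iSup_le fun z => iSup_le fun v => iSup_le fun hz => iSup_le fun hr => iSup_le fun hv => ?_
  exact le_iSup_of_le z (le_iSup_of_le v (le_iSup_of_le hz (le_iSup_of_le (hr.trans hrs)
    (le_iSup_of_le hv le_rfl))))

/-- Finiteness of `goldilocksM` forces the metric to be positive on unit vectors at `z`, so the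
inverse can be cancelled. -/
theorem enorm_le_mul_goldilocksM (ho : IsOpen Ω) {U : Set (CSpace d)} {r : ℝ} {z : CSpace d}
    (hz : z ∈ Ω ∩ U) (hr : boundaryDist Ω z ≤ r) (hM : goldilocksM Ω U r ≠ ⊤) (v : CSpace d) :
    ‖v‖ₑ ≤ ENNReal.ofReal (kobayashiMetric Ω z v) * goldilocksM Ω U r := by
  rcases eq_or_ne v 0 with rfl | hv
  · simp
  have hn : 0 < ‖v‖ := norm_pos_iff.2 hv
  set u : CSpace d := ((‖v‖⁻¹ : ℝ) : ℂ) • v with hu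
  have hu1 : ‖u‖ = 1 := by
    rw [hu, norm_smul, Complex.norm_real, Real.norm_of_nonneg (by positivity),
      inv_mul_cancel₀ hn.ne']
  have h1 : (ENNReal.ofReal (kobayashiMetric Ω z u))⁻¹ ≤ goldilocksM Ω U r :=
    le_iSup_of_le z (le_iSup_of_le u (le_iSup_of_le hz (le_iSup_of_le hr
      (le_iSup_of_le hu1 le_rfl))))
  have h2 : ENNReal.ofReal (kobayashiMetric Ω z u) ≠ 0 :=
    ENNReal.inv_ne_top.1 (ne_top_of_le_ne_top hM h1)
  have h3 := norm_mul_kobayashiMetric_le ho hz.1 hv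
  calc ‖v‖ₑ = ENNReal.ofReal ‖v‖ * (ENNReal.ofReal (kobayashiMetric Ω z u) *
        (ENNReal.ofReal (kobayashiMetric Ω z u))⁻¹) := by
        rw [ENNReal.mul_inv_cancel h2 ENNReal.ofReal_ne_top, mul_one, ofReal_norm]
    _ = ENNReal.ofReal (‖v‖ * kobayashiMetric Ω z u) *
        (ENNReal.ofReal (kobayashiMetric Ω z u))⁻¹ := by
        rw [ENNReal.ofReal_mul hn.le, mul_assoc]
    _ ≤ _ := mul_le_mul' (ENNReal.ofReal_le_ofReal h3) h1

theorem boundaryDist_pos (ho : IsOpen Ω) (hne : (frontier Ω).Nonempty) {z : CSpace d}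
    (hz : z ∈ Ω) : 0 < boundaryDist Ω z := by
  refine (isClosed_frontier.notMem_iff_infDist_pos hne).1 fun h => ?_
  rw [ho.frontier_eq] at h
  exact h.2 hz

/-- Almost-geodesics that stay close to the boundary in a neighbourhood of a local Goldilocks
point are short in the Euclidean sense. -/
theorem exists_norm_sub_lt_of_boundaryDist_le (ho : IsOpen Ω) (hc : IsConnected Ω)
    (hne : (frontier Ω).Nonempty) {U : Set (CSpace d)} {ε : ℝ} (hε : 0 < ε)
    (hI : ∫⁻ r in Ioo 0 ε, (ENNReal.ofReal r)⁻¹ * goldilocksM Ω U r < ⊤)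
    {z₀ : CSpace d} (hz₀ : z₀ ∈ Ω) {C α : ℝ} (hα : 0 < α)
    (hlog : ∀ z ∈ Ω ∩ U, kobayashiDist Ω z₀ z ≤ C + α * Real.log (1 / boundaryDist Ω z))
    {lam : ℝ} (hlam : 1 ≤ lam) (κ : ℝ) {s : ℝ} (hs : 0 < s) :
    ∃ m, 0 < m ∧ ∀ (a b : ℝ) (σ : ℝ → CSpace d), a ≤ b → IsAlmostGeodesic Ω lam κ a b σ →
      (∀ t ∈ Icc a b, σ t ∈ U) → (∀ t ∈ Icc a b, boundaryDist Ω (σ t) ≤ m) →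
      ‖σ b - σ a‖ < s := by
  have hlam0 : 0 < lam := by linarith
  -- `A` and `B` come from solving `2α log δ ≤ κ + 2C - lam⁻¹ |t - τ|` for the boundary distance
  -- `δ`.
  set B : ℝ := lam⁻¹ / (2 * α) with hB
  set A : ℝ := Real.exp ((κ + 2 * C) / (2 * α)) with hA
  have hB0 : 0 < B := by positivity
  have hA0 : 0 < A := Real.exp_pos _
  have hmono := goldilocksM_mono Ω U
  obtain ⟨m, hm, hmtop, hmI⟩ := hmono.exists_lintegral_exp_le hε hI hA0 hB0
    (η := ENNReal.ofReal (s / (2 * lam))) (by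
      rw [ne_eq, ENNReal.ofReal_eq_zero, not_le]; positivity)
  refine ⟨m, hm, fun a b σ hab hσ hU hδ => ?_⟩
  have hcont : ContinuousOn (fun t => boundaryDist Ω (σ t)) (Icc a b) :=
    (Metric.continuous_infDist_pt _).comp_continuousOn (hσ.continuousOn hab)
  -- Measuring time from the maximum of the boundary distance lets the logarithmic term at `τ` be
  -- bounded by the one at `t`.
  obtain ⟨τ, hτ, hmax⟩ := isCompact_Icc.exists_isMaxOn (nonempty_Icc.2 hab) hcont
  have hdecay : ∀ t ∈ Icc a b, boundaryDist Ω (σ t) ≤ A * Real.exp (-B * |t - τ|) := by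
    intro t ht
    have hpt := boundaryDist_pos ho hne (hσ.mem t ht)
    have hpτ := boundaryDist_pos ho hne (hσ.mem τ hτ)
    have e1 := hσ.lower τ hτ t ht
    have e2 := kobayashiDist_triangle ho hc (hσ.mem t ht) hz₀ (hσ.mem τ hτ)
    have e3 := hlog (σ t) ⟨hσ.mem t ht, hU t ht⟩
    have e4 := hlog (σ τ) ⟨hσ.mem τ hτ, hU τ hτ⟩
    rw [kobayashiDist_comm] at e3
    have e5 : Real.log (boundaryDist Ω (σ t)) ≤ Real.log (boundaryDist Ω (σ τ)) :=
      Real.log_le_log hpt (hmax ht)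
    rw [one_div, Real.log_inv] at e3 e4
    have e6 : 2 * α * Real.log (boundaryDist Ω (σ t)) ≤ κ + 2 * C - lam⁻¹ * |t - τ| := by
      nlinarith
    have e7 : Real.log (boundaryDist Ω (σ t)) ≤ (κ + 2 * C) / (2 * α) + -B * |t - τ| := by
      have : (κ + 2 * C) / (2 * α) + -B * |t - τ| = (κ + 2 * C - lam⁻¹ * |t - τ|) / (2 * α) := by
        rw [hB]; field_simp; ring
      rw [this, le_div_iff₀ (by positivity)]
      linarith
    rw [hA, ← Real.exp_add]
    exact (Real.log_le_iff_le_exp hpt).1 e7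
  have hint : ‖σ b - σ a‖ₑ ≤ ENNReal.ofReal lam *
      ∫⁻ t : ℝ, goldilocksM Ω U (min m (A * Real.exp (-B * |t|))) := by
    calc ‖σ b - σ a‖ₑ ≤ ∫⁻ t in Icc a b, ‖deriv σ t‖ₑ :=
          hσ.absolutelyContinuous.enorm_sub_le_lintegral hab
      _ ≤ ∫⁻ t in Icc a b, ENNReal.ofReal lam *
          goldilocksM Ω U (min m (A * Real.exp (-B * |t - τ|))) := by
          refine lintegral_mono_ae ?_
          filter_upwards [hσ.speed, ae_restrict_mem measurableSet_Icc] with t h1 ht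
          have h2 : boundaryDist Ω (σ t) ≤ min m (A * Real.exp (-B * |t - τ|)) :=
            le_min (hδ t ht) (hdecay t ht)
          refine (enorm_le_mul_goldilocksM ho ⟨hσ.mem t ht, hU t ht⟩ h2
            (ne_top_of_le_ne_top hmtop (hmono (min_le_left _ _))) _).trans ?_
          gcongr
      _ ≤ ∫⁻ t, ENNReal.ofReal lam *
          goldilocksM Ω U (min m (A * Real.exp (-B * |t - τ|))) := setLIntegral_le_lintegral _ _
      _ = ENNReal.ofReal lam *
          ∫⁻ t, goldilocksM Ω U (min m (A * Real.exp (-B * |t - τ|))) :=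
          lintegral_const_mul' _ _ ENNReal.ofReal_ne_top
      _ = _ := by
          -- Translation removes `τ`, so `m` does not depend on the curve.
          rw [lintegral_sub_right_eq_self
            (fun t => goldilocksM Ω U (min m (A * Real.exp (-B * |t|)))) τ]
  have hfin : ‖σ b - σ a‖ₑ ≤ ENNReal.ofReal (s / 2) := by
    refine hint.trans ((mul_le_mul' le_rfl hmI).trans_eq ?_)
    rw [← ENNReal.ofReal_mul hlam0.le]
    congr 1
    field_simp
  rw [← ofReal_norm, ENNReal.ofReal_le_ofReal_iff (by positivity)] at hfin
  linarith

/-- The points of the closure of `Ω` in a closed ball that are at distance at least `m` from the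
boundary form a compact set. -/
theorem isCompact_boundaryDist_ge (Ω : Set (CSpace d)) (x : CSpace d) (r m : ℝ) :
    IsCompact {z | z ∈ Metric.closedBall x r ∩ closure Ω ∧ m ≤ boundaryDist Ω z} := by
  refine ((isCompact_closedBall x r).inter_right isClosed_closure).inter_right ?_
  exact isClosed_le continuous_const (Metric.continuous_infDist_pt _)

theorem mem_of_boundaryDist_pos (ho : IsOpen Ω) {z : CSpace d} (hz : z ∈ closure Ω)
    (h : 0 < boundaryDist Ω z) : z ∈ Ω := by
  by_contra hn
  have : z ∈ frontier Ω := by rw [ho.frontier_eq]; exact ⟨hz, hn⟩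
  exact h.ne' (Metric.infDist_zero_of_mem this)

/-- Near a local Goldilocks point, every almost-geodesic that travels a fixed Euclidean distance
meets a fixed compact subset of `Ω`. -/
theorem IsLocalGoldilocksPoint.exists_compact (ho : IsOpen Ω) (hc : IsConnected Ω)
    {x : CSpace d} (hx : IsLocalGoldilocksPoint Ω x) {lam : ℝ} (hlam : 1 ≤ lam) (κ : ℝ) :
    ∃ ρ₀ > 0, ∀ ρ, ρ ≤ ρ₀ → ∀ s, 0 < s → ∃ Q, IsCompact Q ∧ Q ⊆ Ω ∧ Q ⊆ Metric.closedBall x ρ ∧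
      ∀ (a b : ℝ) (σ : ℝ → CSpace d), a ≤ b → IsAlmostGeodesic Ω lam κ a b σ →
        (∀ t ∈ Icc a b, σ t ∈ Metric.closedBall x ρ) → s ≤ ‖σ b - σ a‖ →
        ∃ t ∈ Icc a b, σ t ∈ Q := by
  obtain ⟨hxf, U, -, hU, ⟨ε, hε, hI⟩, hlog⟩ := hx
  obtain ⟨z₀, hz₀⟩ := hc.nonempty
  obtain ⟨C, α, -, hα, hlog⟩ := hlog z₀ hz₀
  obtain ⟨ρ₀, hρ₀, hball⟩ := Metric.mem_nhdsWithin_iff.1 hU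
  refine ⟨ρ₀ / 2, by positivity, fun ρ hρ s hs => ?_⟩
  obtain ⟨m, hm, h⟩ := exists_norm_sub_lt_of_boundaryDist_le ho hc ⟨x, hxf⟩ hε hI hz₀ hα hlog
    hlam κ hs
  refine ⟨_, isCompact_boundaryDist_ge Ω x ρ m,
    fun z hz => mem_of_boundaryDist_pos ho hz.1.2 (hm.trans_le hz.2), fun z hz => hz.1.1,
    fun a b σ hab hσ hmem hs' => ?_⟩
  by_contra! hcon
  refine absurd (h a b σ hab hσ (fun t ht => hball ⟨?_, subset_closure (hσ.mem t ht)⟩)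
    fun t ht => ?_) (not_lt.2 hs')
  · exact Metric.closedBall_subset_ball (by linarith) (hmem t ht)
  · by_contra! h1
    exact hcon t ht ⟨⟨hmem t ht, subset_closure (hσ.mem t ht)⟩, h1.le⟩

/-- The non-Goldilocks boundary points form a closed set. -/
theorem isClosed_frontier_diff_localGoldilocksBoundary (Ω : Set (CSpace d)) :
    IsClosed (frontier Ω \ localGoldilocksBoundary Ω) := by
  rw [← isOpen_compl_iff, isOpen_iff_mem_nhds]
  intro x hx
  by_cases hxf : x ∈ frontier Ω
  · have hg : IsLocalGoldilocksPoint Ω x := by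
      by_contra h; exact hx ⟨hxf, h⟩
    obtain ⟨-, U, hUs, hU, hrest⟩ := hg
    obtain ⟨ρ, hρ, hball⟩ := Metric.mem_nhdsWithin_iff.1 hU
    -- The same `U` witnesses the property at every nearby boundary point.
    refine mem_of_superset (Metric.ball_mem_nhds x hρ) fun y hy hyN => hyN.2 ⟨hyN.1, U, hUs, ?_, hrest⟩
    exact mem_nhdsWithin.2 ⟨_, Metric.isOpen_ball, hy, hball⟩
  · exact mem_of_superset (isClosed_frontier.isOpen_compl.mem_nhds hxf) fun y hy hyN => hy hyN.1

/-! ### Topological preliminaries -/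

/-- A closed totally disconnected subset of a proper metric space avoids the frontiers of
arbitrarily small neighbourhoods of each point. -/
theorem IsTotallyDisconnected.exists_isOpen_disjoint_frontier {E : Type*} [MetricSpace E]
    [ProperSpace E] {N : Set E} (hN : IsTotallyDisconnected N) (hNc : IsClosed N) (x : E) {ε : ℝ}
    (hε : 0 < ε) :
    ∃ G, IsOpen G ∧ x ∈ G ∧ G ⊆ Metric.ball x ε ∧ Disjoint (frontier G) N := by
  by_cases hx : x ∈ N
  · set Y : Set E := N ∩ Metric.closedBall x ε with hY
    have hYc : IsCompact Y := (isCompact_closedBall x ε).inter_left hNc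
    have : CompactSpace Y := isCompact_iff_compactSpace.1 hYc
    have : TotallyDisconnectedSpace Y :=
      totallyDisconnectedSpace_subtype_iff.2 (fun t ht => hN t (ht.trans inter_subset_left))
    have hxY : x ∈ Y := ⟨hx, Metric.mem_closedBall_self hε.le⟩
    -- Total disconnectedness gives a small clopen piece `D` around `x`. It is compact and, lying in
    -- the open ball, relatively open in all of `N`; normality then separates it from the closed set
    -- `N \ D'`.
    obtain ⟨D, hD, hxD, hDsub⟩ := compact_exists_isClopen_in_isOpen (x := (⟨x, hxY⟩ : Y))
      (U := Subtype.val ⁻¹' Metric.ball x ε) (Metric.isOpen_ball.preimage continuous_subtype_val)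
      (Metric.mem_ball_self hε)
    obtain ⟨O, hO, hOD⟩ := isOpen_induced_iff.1 hD.2
    set D' : Set E := Subtype.val '' D with hD'
    have hD'c : IsClosed D' := (hD.1.isCompact.image continuous_subtype_val).isClosed
    have hD'ball : D' ⊆ Metric.ball x ε := by
      rintro _ ⟨y, hy, rfl⟩; exact hDsub hy
    have hD'eq : D' = N ∩ (O ∩ Metric.ball x ε) := by
      ext y
      constructor
      · rintro ⟨y, hy, rfl⟩
        refine ⟨y.2.1, ?_, hDsub hy⟩
        rw [← hOD] at hy
        exact hy
      · rintro ⟨hyN, hyO, hyb⟩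
        refine ⟨⟨y, hyN, Metric.ball_subset_closedBall hyb⟩, ?_, rfl⟩
        rw [← hOD]
        exact hyO
    have hrest : IsClosed (N \ D') := by
      have : N \ D' = N ∩ (O ∩ Metric.ball x ε)ᶜ := by
        rw [hD'eq]; ext y; simp only [Set.mem_sdiff, mem_inter_iff, mem_compl_iff]; tauto
      rw [this]
      exact hNc.inter (hO.inter Metric.isOpen_ball).isClosed_compl
    obtain ⟨G, hG, hDG, hGsub⟩ := normal_exists_closure_subset hD'c
      (Metric.isOpen_ball.inter hrest.isOpen_compl)
      (subset_inter hD'ball fun y hy hy' => hy'.2 hy)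
    refine ⟨G, hG, hDG ⟨_, hxD, rfl⟩, fun y hy => (hGsub (subset_closure hy)).1, ?_⟩
    rw [Set.disjoint_left]
    intro y hy hyN
    rw [hG.frontier_eq] at hy
    by_cases hyD : y ∈ D'
    · exact hy.2 (hDG hyD)
    · exact (hGsub hy.1).2 ⟨hyN, hyD⟩
  · obtain ⟨r, hr, hball⟩ := Metric.isOpen_iff.1 hNc.isOpen_compl x hx
    have hm : 0 < min (r / 2) ε := lt_min (by positivity) hε
    refine ⟨Metric.ball x (min (r / 2) ε), Metric.isOpen_ball, Metric.mem_ball_self hm,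
      Metric.ball_subset_ball (min_le_right _ _), ?_⟩
    rw [Set.disjoint_left]
    intro y hy hyN
    refine hball ?_ hyN
    have h1 := Metric.closure_ball_subset_closedBall (frontier_subset_closure hy)
    exact Metric.closedBall_subset_ball ((min_le_left _ _).trans_lt (by linarith)) h1

/-- The exit time is the least element of the compact set of times spent outside `G`. -/
theorem ContinuousOn.exists_first_exit {E : Type*} [TopologicalSpace E] {σ : ℝ → E} {a b : ℝ}
    (hab : a ≤ b) (hσ : ContinuousOn σ (Icc a b)) {G : Set E} (hG : IsOpen G) (ha : σ a ∈ G)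
    (hb : σ b ∉ G) :
    ∃ t ∈ Icc a b, σ t ∈ frontier G ∧ ∀ s ∈ Icc a t, σ s ∈ closure G := by
  have hcl : IsClosed (Icc a b ∩ σ ⁻¹' Gᶜ) :=
    hσ.preimage_isClosed_of_isClosed isClosed_Icc hG.isClosed_compl
  obtain ⟨t, ⟨ht, htG⟩, hleast⟩ := (isCompact_Icc.of_isClosed_subset hcl
    inter_subset_left).exists_isLeast ⟨b, right_mem_Icc.2 hab, hb⟩
  have hbefore : ∀ s ∈ Ico a t, σ s ∈ G := fun s hs => by
    by_contra h
    exact absurd (hleast ⟨⟨hs.1, hs.2.le.trans ht.2⟩, h⟩) (not_le.2 hs.2)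
  have hat : a < t := lt_of_le_of_ne ht.1 fun h => htG (h ▸ ha)
  have htcl : σ t ∈ closure G := by
    have h1 : t ∈ closure (Ico a t) := by
      rw [closure_Ico hat.ne]; exact right_mem_Icc.2 hat.le
    have h2 : ContinuousWithinAt σ (Ico a t) t :=
      (hσ t ht).mono fun s hs => ⟨hs.1, hs.2.le.trans ht.2⟩
    exact closure_mono (image_subset_iff.2 hbefore) (h2.mem_closure_image h1)
  refine ⟨t, ht, ?_, fun s hs => ?_⟩
  · rw [hG.frontier_eq]; exact ⟨htcl, htG⟩
  · rcases hs.2.eq_or_lt with rfl | h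
    · exact htcl
    · exact subset_closure (hbefore s ⟨hs.1, h⟩)

theorem IsCompact.exists_tendsto_ultrafilter {E ι : Type*} [TopologicalSpace E] {K : Set E}
    (hK : IsCompact K) (𝒰 : Ultrafilter ι) {f : ι → E} (hf : ∀ᶠ i in 𝒰, f i ∈ K) :
    ∃ x ∈ K, Tendsto f 𝒰 (𝓝 x) :=
  hK.ultrafilter_le_nhds' (𝒰.map f) hf

/-- If a family of sets eventually avoids some neighbourhood of each point of a compact set `K`,
then it eventually avoids `K`. -/
theorem IsCompact.eventually_disjoint {E ι : Type*} [TopologicalSpace E] {K : Set E}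
    (hK : IsCompact K) {l : Filter ι} {C : ι → Set E}
    (h : ∀ x ∈ K, ∃ V ∈ 𝓝 x, ∀ᶠ i in l, Disjoint (C i) V) : ∀ᶠ i in l, Disjoint (C i) K := by
  refine hK.induction_on (p := fun s => ∀ᶠ i in l, Disjoint (C i) s) (by simp)
    (fun s t hst ht => ht.mono fun i hi => hi.mono_right hst)
    (fun s t hs ht => by filter_upwards [hs, ht] with i h1 h2 using h1.union_right h2)
    fun x hx => ?_
  obtain ⟨V, hV, h⟩ := h x hx
  exact ⟨V, mem_nhdsWithin_of_mem_nhds hV, h⟩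

/-! ### Families of almost-geodesics that leave every compact subset of the domain -/

/-- If almost-geodesics that leave all compact subsets of `Ω` come close to a local Goldilocks
point, then they converge to that point. -/
theorem IsLocalGoldilocksPoint.eventually_subset_closedBall (ho : IsOpen Ω) (hc : IsConnected Ω)
    {x : CSpace d} (hx : IsLocalGoldilocksPoint Ω x) {lam κ : ℝ} (hlam : 1 ≤ lam)
    {ι : Type*} {l : Filter ι} {T : ι → ℝ} {σ : ι → ℝ → CSpace d}
    (hσ : ∀ i, IsAlmostGeodesic Ω lam κ 0 (T i) (σ i))
    (havoid : ∀ K, IsCompact K → K ⊆ Ω → ∀ᶠ i in l, Disjoint (σ i '' Icc 0 (T i)) K)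
    (hmeet : ∀ V ∈ 𝓝 x, ∀ᶠ i in l, ¬ Disjoint (σ i '' Icc 0 (T i)) V) {r : ℝ} (hr : 0 < r) :
    ∀ᶠ i in l, σ i '' Icc 0 (T i) ⊆ Metric.closedBall x r := by
  obtain ⟨ρ₀, hρ₀, h⟩ := hx.exists_compact ho hc hlam κ
  -- A curve that visits the ball of radius `ρ / 2` and leaves the ball of radius `ρ` travels at
  -- least `ρ / 2` inside the larger closed ball, so it meets `Q`.
  set ρ := min ρ₀ r with hρ
  have hρ0 : 0 < ρ := lt_min hρ₀ hr
  obtain ⟨Q, hQc, hQΩ, -, hQ⟩ := h ρ (min_le_left _ _) (ρ / 2) (by positivity)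
  filter_upwards [havoid Q hQc hQΩ, hmeet _ (Metric.ball_mem_nhds x (show 0 < ρ / 2 by positivity))]
    with i hi hi'
  obtain ⟨_, ⟨t₀, ht₀, rfl⟩, ht₀b⟩ := Set.not_disjoint_iff.1 hi'
  rintro _ ⟨t₁, ht₁, rfl⟩
  have hT : 0 ≤ T i := ht₀.1.trans ht₀.2
  have hcont := (hσ i).continuousOn hT
  by_contra hout
  have hout' : σ i t₁ ∉ Metric.ball x ρ := fun hin =>
    hout (Metric.closedBall_subset_closedBall (min_le_right _ _) (Metric.ball_subset_closedBall hin))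
  have hin : σ i t₀ ∈ Metric.ball x ρ := Metric.ball_subset_ball (by linarith) ht₀b
  have hfar : ∀ z ∈ frontier (Metric.ball x ρ), ρ / 2 ≤ ‖z - σ i t₀‖ := fun z hz => by
    have h1 : dist z x = ρ := Metric.frontier_ball_subset_sphere hz
    rw [Metric.mem_ball] at ht₀b
    have := dist_triangle z (σ i t₀) x
    rw [← dist_eq_norm]
    linarith
  have hno : ∀ t ∈ Icc 0 (T i), σ i t ∉ Q := fun t ht htQ =>
    Set.disjoint_left.1 hi ⟨t, ht, rfl⟩ htQ
  rcases le_total t₀ t₁ with h01 | h01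
  · obtain ⟨t, ht, htf, hts⟩ := (hcont.mono (Icc_subset_Icc ht₀.1 ht₁.2)).exists_first_exit h01
      Metric.isOpen_ball hin hout'
    have htT : t ≤ T i := ht.2.trans ht₁.2
    obtain ⟨u, hu, huQ⟩ := hQ t₀ t (σ i) ht.1 ((hσ i).mono ht₀.1 ht.1 htT)
      (fun s hs => Metric.closure_ball_subset_closedBall (hts s hs)) (hfar _ htf)
    exact hno u ⟨ht₀.1.trans hu.1, hu.2.trans htT⟩ huQ
  -- Time reversal is used only to locate the crossing; the estimate is applied to the original
  -- curve.
  · have hc2 : ContinuousOn (fun s => σ i (-s)) (Icc (-t₀) (-t₁)) :=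
      hcont.comp continuous_neg.continuousOn fun s hs =>
        ⟨by linarith [hs.2, ht₁.1], by linarith [hs.1, ht₀.2]⟩
    obtain ⟨t, ht, htf, hts⟩ := hc2.exists_first_exit (neg_le_neg h01) Metric.isOpen_ball
      (by simpa using hin) (by simpa using hout')
    have h1 : -t ≤ t₀ := by linarith [ht.1]
    have h2 : 0 ≤ -t := by linarith [ht.2, ht₁.1]
    obtain ⟨u, hu, huQ⟩ := hQ (-t) t₀ (σ i) h1 ((hσ i).mono h2 h1 ht₀.2)
      (fun s hs => by
        have := Metric.closure_ball_subset_closedBall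
          (hts (-s) ⟨by linarith [hs.2], by linarith [hs.1]⟩)
        simpa using this) (by
        rw [norm_sub_rev]; exact hfar _ htf)
    exact hno u ⟨h2.trans hu.1, hu.2.trans ht₀.2⟩ huQ

/-- Almost-geodesics that leave all compact subsets of `Ω` either accumulate at a single
boundary point or leave all compact sets. -/
theorem exists_eventually_subset_closedBall_or_eventually_disjoint (ho : IsOpen Ω)
    (hc : IsConnected Ω) (htd : IsTotallyDisconnected (frontier Ω \ localGoldilocksBoundary Ω))
    {lam κ : ℝ} (hlam : 1 ≤ lam) {ι : Type*} (𝒰 : Ultrafilter ι) {T : ι → ℝ}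
    {σ : ι → ℝ → CSpace d} (hT : ∀ i, 0 ≤ T i)
    (hσ : ∀ i, IsAlmostGeodesic Ω lam κ 0 (T i) (σ i))
    (havoid : ∀ K, IsCompact K → K ⊆ Ω → ∀ᶠ i in 𝒰, Disjoint (σ i '' Icc 0 (T i)) K) :
    (∃ x ∈ closure Ω, ∀ r > 0, ∀ᶠ i in 𝒰, σ i '' Icc 0 (T i) ⊆ Metric.closedBall x r) ∨
      ∀ K, IsCompact K → ∀ᶠ i in 𝒰, Disjoint (σ i '' Icc 0 (T i)) K := by
  rw [or_iff_not_imp_left]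
  intro hno
  push Not at hno
  have key : ∀ x, ∃ V ∈ 𝓝 x, ∀ᶠ i in 𝒰, Disjoint (σ i '' Icc 0 (T i)) V := by
    have hN : ∀ x ∉ frontier Ω \ localGoldilocksBoundary Ω,
        ∃ V ∈ 𝓝 x, ∀ᶠ i in 𝒰, Disjoint (σ i '' Icc 0 (T i)) V := by
      intro x hx
      by_cases hxΩ : x ∈ Ω
      · obtain ⟨K, hK, hKΩ, hKc⟩ := local_compact_nhds (ho.mem_nhds hxΩ)
        exact ⟨K, hK, havoid K hKc hKΩ⟩
      by_cases hxc : x ∈ closure Ω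
      · have hxf : x ∈ frontier Ω := by rw [ho.frontier_eq]; exact ⟨hxc, hxΩ⟩
        have hxg : IsLocalGoldilocksPoint Ω x := by
          by_contra h; exact hx ⟨hxf, h⟩
        by_contra hmeet
        obtain ⟨r, hr, h⟩ := hno x hxc
        refine Ultrafilter.eventually_not.1 h
          (hxg.eventually_subset_closedBall ho hc hlam hσ havoid (fun V hV => ?_) hr)
        exact Ultrafilter.eventually_not.2 fun h' => hmeet ⟨V, hV, h'⟩
      · refine ⟨_, isClosed_closure.isOpen_compl.mem_nhds hxc, Eventually.of_forall fun i => ?_⟩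
        rw [disjoint_compl_right_iff_subset]
        rintro _ ⟨t, ht, rfl⟩
        exact subset_closure ((hσ i).mem t ht)
    intro x
    by_cases hx : x ∈ frontier Ω \ localGoldilocksBoundary Ω
    swap
    · exact hN x hx
    by_contra hmeet
    obtain ⟨r, hr, h⟩ := hno x (frontier_subset_closure hx.1)
    refine Ultrafilter.eventually_not.1 h ?_
    -- The frontier of `G` consists of points already handled by `hN`, so the curves avoid it. Being
    -- connected and meeting `G`, they lie inside `G`.
    obtain ⟨G, hG, hxG, hGr, hGf⟩ := htd.exists_isOpen_disjoint_frontier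
      (isClosed_frontier_diff_localGoldilocksBoundary Ω) x hr
    have hGc : IsCompact (frontier G) :=
      (isCompact_closedBall x r).of_isClosed_subset isClosed_frontier
        (frontier_subset_closure.trans
          ((closure_mono hGr).trans Metric.closure_ball_subset_closedBall))
    have h1 : ∀ᶠ i in 𝒰, Disjoint (σ i '' Icc 0 (T i)) (frontier G) :=
      hGc.eventually_disjoint fun y hy => hN y (Set.disjoint_left.1 hGf hy)
    have h2 : ∀ᶠ i in 𝒰, ¬ Disjoint (σ i '' Icc 0 (T i)) G :=
      Ultrafilter.eventually_not.2 fun h' => hmeet ⟨G, hG.mem_nhds hxG, h'⟩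
    filter_upwards [h1, h2] with i hi1 hi2
    have hpre : IsPreconnected (σ i '' Icc 0 (T i)) :=
      isPreconnected_Icc.image _ ((hσ i).continuousOn (hT i))
    refine Subset.trans ?_ (hGr.trans Metric.ball_subset_closedBall)
    by_contra hsub
    obtain ⟨y, hy, hyG⟩ := Set.not_subset.1 hsub
    obtain ⟨u, hu, huG, huG'⟩ := hpre G (closure G)ᶜ hG isClosed_closure.isOpen_compl
      (fun z hz => by
        by_cases hzG : z ∈ G
        · exact Or.inl hzG
        · refine Or.inr fun hzc => Set.disjoint_left.1 hi1 hz ?_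
          rw [hG.frontier_eq]
          exact ⟨hzc, hzG⟩)
      (Set.not_disjoint_iff_nonempty_inter.1 hi2)
      ⟨y, hy, fun hyc => Set.disjoint_left.1 hi1 hy (by
        rw [hG.frontier_eq]; exact ⟨hyc, hyG⟩)⟩
    exact huG' (subset_closure huG)
  exact fun K hK => hK.eventually_disjoint fun x _ => key x

/-! ### Ends of the closure -/

/-- Near a boundary point outside the exceptional set, or at a point of `Ω`, an almost-geodesic
that leaves a neighbourhood meets a fixed compact subset of `Ω` on its way. -/
theorem exists_compact_of_tendsto (ho : IsOpen Ω) (hc : IsConnected Ω) {x z₀ : CSpace d}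
    (hxc : x ∈ closure Ω) (hx : x ∉ frontier Ω \ localGoldilocksBoundary Ω) {r : ℝ} (hr : 0 < r)
    (hz₀ : z₀ ∉ Metric.ball x r) {lam κ : ℝ} (hlam : 1 ≤ lam) {ι : Type*} {l : Filter ι}
    {a b : ι → ℝ} {σ : ι → ℝ → CSpace d}
    (hσ : ∀ᶠ i in l, a i ≤ b i ∧ IsAlmostGeodesic Ω lam κ (a i) (b i) (σ i) ∧ σ i (b i) = z₀)
    (hlim : Tendsto (fun i => σ i (a i)) l (𝓝 x)) :
    ∃ Q, IsCompact Q ∧ Q ⊆ Ω ∧ Q ⊆ Metric.closedBall x r ∧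
      ∀ᶠ i in l, ∃ t ∈ Icc (a i) (b i), σ i t ∈ Q ∧
        ∀ s ∈ Icc (a i) t, σ i s ∈ Metric.closedBall x r := by
  by_cases hxΩ : x ∈ Ω
  -- For an interior limit, a small closed ball serves as `Q` and already contains the starting
  -- point.
  · obtain ⟨ε, hε, hball⟩ := Metric.nhds_basis_closedBall.mem_iff.1 (ho.mem_nhds hxΩ)
    refine ⟨Metric.closedBall x (min ε r), isCompact_closedBall _ _,
      (Metric.closedBall_subset_closedBall (min_le_left _ _)).trans hball,
      Metric.closedBall_subset_closedBall (min_le_right _ _), ?_⟩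
    filter_upwards [hσ, hlim (Metric.closedBall_mem_nhds x (lt_min hε hr))] with i hi hi'
    refine ⟨a i, ⟨le_rfl, hi.1⟩, hi', fun s hs => ?_⟩
    rw [Icc_self, mem_singleton_iff] at hs
    rw [hs]
    exact Metric.closedBall_subset_closedBall (min_le_right _ _) hi'
  have hxf : x ∈ frontier Ω := by rw [ho.frontier_eq]; exact ⟨hxc, hxΩ⟩
  have hxg : IsLocalGoldilocksPoint Ω x := by
    by_contra h; exact hx ⟨hxf, h⟩
  obtain ⟨ρ₀, hρ₀, h⟩ := hxg.exists_compact ho hc hlam κ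
  set ρ := min ρ₀ r with hρ
  have hρ0 : 0 < ρ := lt_min hρ₀ hr
  obtain ⟨Q, hQc, hQΩ, hQb, hQ⟩ := h ρ (min_le_left _ _) (ρ / 2) (by positivity)
  have hρr : Metric.closedBall x ρ ⊆ Metric.closedBall x r :=
    Metric.closedBall_subset_closedBall (min_le_right _ _)
  refine ⟨Q, hQc, hQΩ, hQb.trans hρr, ?_⟩
  filter_upwards [hσ, hlim (Metric.ball_mem_nhds x (show 0 < ρ / 2 by positivity))]
    with i ⟨hab, hgeo, hend⟩ hi
  have hi2 : σ i (a i) ∈ Metric.ball x (ρ / 2) := hi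
  obtain ⟨t, ht, htf, hts⟩ := (hgeo.continuousOn hab).exists_first_exit hab
    (Metric.isOpen_ball (x := x) (ε := ρ)) (Metric.ball_subset_ball (by linarith) hi2)
    (by rw [hend]; exact fun h => hz₀ (Metric.ball_subset_ball (min_le_right _ _) h))
  have hts' : ∀ s ∈ Icc (a i) t, σ i s ∈ Metric.closedBall x ρ := fun s hs =>
    Metric.closure_ball_subset_closedBall (hts s hs)
  obtain ⟨u, hu, huQ⟩ := hQ (a i) t (σ i) ht.1 (hgeo.mono le_rfl ht.1 ht.2) hts' (by
    have h1 : dist (σ i t) x = ρ := Metric.frontier_ball_subset_sphere htf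
    rw [Metric.mem_ball] at hi2
    have := dist_triangle (σ i t) (σ i (a i)) x
    rw [← dist_eq_norm]
    linarith)
  exact ⟨u, ⟨hu.1, hu.2.trans ht.2⟩, huQ, fun s hs => hρr (hts' s ⟨hs.1, hs.2.trans hu.2⟩)⟩

/-- Points of `Ω` that tend to infinity along an ultrafilter eventually lie in a single component
of the part of `Ω` outside a given large ball. -/
theorem exists_eventually_mem_connectedComponentIn (ho : IsOpen Ω) (hc : IsConnected Ω)
    (htd : IsTotallyDisconnected (frontier Ω \ localGoldilocksBoundary Ω)) {ι : Type*}
    (𝒰 : Ultrafilter ι) {p : ι → CSpace d} (hp : ∀ i, p i ∈ Ω)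
    (hinf : ∀ R, ∀ᶠ i in 𝒰, R < ‖p i‖) {z₀ : CSpace d} (hz₀ : z₀ ∈ Ω) {R : ℝ} (hR : ‖z₀‖ < R) :
    ∃ w ∈ Ω \ Metric.closedBall 0 R,
      ∀ᶠ i in 𝒰, p i ∈ connectedComponentIn (Ω \ Metric.closedBall 0 R) w := by
  choose L τ hL hτ hτ0 hτL using fun i => exists_isAlmostGeodesic ho hc (hp i) hz₀
  have hcont : ∀ i, ContinuousOn (τ i) (Icc 0 (L i)) := fun i => (hτ i).continuousOn (hL i)
  -- the first entrance into a larger ball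
  have h1 : ∀ᶠ i in 𝒰, ∃ t ∈ Icc 0 (L i), ‖τ i t‖ = R + 1 ∧ ∀ s ∈ Icc 0 t, R < ‖τ i s‖ := by
    filter_upwards [hinf (R + 1)] with i hi
    obtain ⟨t, ht, htf, hts⟩ := (hcont i).exists_first_exit (hL i)
      (G := (Metric.closedBall 0 (R + 1))ᶜ) Metric.isClosed_closedBall.isOpen_compl
      (by simpa [hτ0] using hi) (by simp [hτL]; linarith)
    refine ⟨t, ht, ?_, fun s hs => ?_⟩
    · rw [frontier_compl] at htf
      simpa using Metric.frontier_closedBall_subset_sphere htf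
    · have h2 : closure ((Metric.closedBall (0 : CSpace d) (R + 1))ᶜ) ⊆ {z | R + 1 ≤ ‖z‖} :=
        closure_minimal (fun z hz => by
          simp only [mem_compl_iff, mem_closedBall_zero_iff, not_le] at hz
          exact hz.le) (isClosed_le continuous_const continuous_norm)
      have h3 : R + 1 ≤ ‖τ i s‖ := h2 (hts s hs)
      linarith
  obtain ⟨t₁, h1⟩ := h1.choice
  obtain ⟨s, hs, hslim⟩ := (isCompact_sphere (0 : CSpace d) (R + 1)).exists_tendsto_ultrafilter 𝒰
    (f := fun i => τ i (t₁ i)) (h1.mono fun i hi => by simpa using hi.2.1)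
  have hsn : ‖s‖ = R + 1 := by simpa using hs
  -- Budget of radii: start on the sphere of radius `R + 1`, lose `1/2` inside `G`, then `1/4` near
  -- the exit point; everything stays beyond `R`.
  have hfar : ∀ x y : CSpace d, ∀ c : ℝ, y ∈ Metric.closedBall x c → ‖x‖ - c ≤ ‖y‖ := by
    intro x y c hy
    rw [mem_closedBall_iff_norm'] at hy
    have := norm_sub_norm_le x y
    linarith
  -- the first exit from a small neighbourhood whose frontier avoids the exceptional set
  obtain ⟨G, hG, hsG, hGb, hGf⟩ := htd.exists_isOpen_disjoint_frontier
    (isClosed_frontier_diff_localGoldilocksBoundary Ω) s (show (0 : ℝ) < 1 / 2 by norm_num)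
  have hGcl : closure G ⊆ Metric.closedBall s (1 / 2) :=
    (closure_mono hGb).trans Metric.closure_ball_subset_closedBall
  have hGc : IsCompact (frontier G) :=
    (isCompact_closedBall s (1 / 2)).of_isClosed_subset isClosed_frontier
      (frontier_subset_closure.trans hGcl)
  have h2 : ∀ᶠ i in 𝒰, ∃ t ∈ Icc 0 (L i), τ i t ∈ frontier G ∧ ∀ s ∈ Icc 0 t, R < ‖τ i s‖ := by
    filter_upwards [h1, hslim (hG.mem_nhds hsG)] with i ⟨ht₁, htn, hts⟩ hi
    obtain ⟨t, ht, htf, htG⟩ := ((hcont i).mono (Icc_subset_Icc_left ht₁.1)).exists_first_exit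
      ht₁.2 hG hi (by
        rw [hτL]
        intro h
        have := hfar _ _ _ (Metric.ball_subset_closedBall (hGb h))
        linarith)
    refine ⟨t, ⟨ht₁.1.trans ht.1, ht.2⟩, htf, fun u hu => ?_⟩
    rcases le_total u (t₁ i) with h3 | h3
    · exact hts u ⟨hu.1, h3⟩
    · have := hfar _ _ _ (hGcl (htG u ⟨h3, hu.2⟩))
      linarith
  obtain ⟨t₂, h2⟩ := h2.choice
  obtain ⟨x, hxf, hxlim⟩ := hGc.exists_tendsto_ultrafilter 𝒰
    (f := fun i => τ i (t₂ i)) (h2.mono fun i hi => hi.2.1)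
  have hxn : R + 1 / 2 ≤ ‖x‖ := by
    have := hfar _ _ _ (hGcl (frontier_subset_closure hxf))
    linarith
  have hxc : x ∈ closure Ω := mem_closure_of_tendsto hxlim
    (h2.mono fun i hi => (hτ i).mem _ hi.1)
  obtain ⟨Q, hQc, hQΩ, hQb, hQ⟩ := exists_compact_of_tendsto ho hc hxc
    (Set.disjoint_left.1 hGf hxf) (show (0 : ℝ) < 1 / 4 by norm_num) (z₀ := z₀)
    (fun h => by
      have := hfar _ _ _ (Metric.ball_subset_closedBall h)
      linarith) le_rfl (κ := 1) (a := t₂) (b := L) (σ := τ) (l := (𝒰 : Filter ι))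
    (h2.mono fun i hi => ⟨hi.1.2, (hτ i).mono hi.1.1 hi.1.2 le_rfl, hτL i⟩) hxlim
  obtain ⟨t₃, h3⟩ := hQ.choice
  obtain ⟨w, hwQ, hwlim⟩ := hQc.exists_tendsto_ultrafilter 𝒰
    (f := fun i => τ i (t₃ i)) (h3.mono fun i hi => hi.2.1)
  have hw : w ∈ Ω \ Metric.closedBall 0 R := by
    refine ⟨hQΩ hwQ, fun h => ?_⟩
    have := hfar _ _ _ (hQb hwQ)
    rw [mem_closedBall_zero_iff] at h
    linarith
  refine ⟨w, hw, ?_⟩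
  -- A ball about the common limit `w` joins the arcs from the different `p i` into one component.
  obtain ⟨ε, hε, hball⟩ := Metric.isOpen_iff.1 (ho.sdiff Metric.isClosed_closedBall) w hw
  filter_upwards [h2, h3, hwlim (Metric.ball_mem_nhds w hε)] with i ⟨ht₂, _, hpath⟩
    ⟨ht₃, _, hpath'⟩ hi
  have h4 : τ i (t₃ i) ∈ connectedComponentIn (Ω \ Metric.closedBall 0 R) w :=
    (convex_ball w ε).isPreconnected.subset_connectedComponentIn (Metric.mem_ball_self hε) hball hi
  rw [connectedComponentIn_eq h4]
  have ht0 : 0 ≤ t₃ i := ht₂.1.trans ht₃.1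
  have h5 : IsPreconnected (τ i '' Icc 0 (t₃ i)) :=
    isPreconnected_Icc.image _ ((hcont i).mono (Icc_subset_Icc_right ht₃.2))
  refine h5.subset_connectedComponentIn ⟨t₃ i, right_mem_Icc.2 ht0, rfl⟩ ?_
    ⟨0, left_mem_Icc.2 ht0, hτ0 i⟩
  rintro _ ⟨u, hu, rfl⟩
  refine ⟨(hτ i).mem u ⟨hu.1, hu.2.trans ht₃.2⟩, fun h => ?_⟩
  rw [mem_closedBall_zero_iff] at h
  rcases le_total u (t₂ i) with h6 | h6
  · linarith [hpath u ⟨hu.1, h6⟩]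
  · have := hfar _ _ _ (hpath' u ⟨h6, hu.2⟩)
    linarith

/-- The components chosen for `K ≤ M` share some `p i`, which makes the choice monotone. -/
theorem exists_topEnd_eventually_mem {X ι : Type*} [TopologicalSpace X] {l : Filter ι} [l.NeBot]
    {p : ι → X} (h : ∀ K : TopologicalSpace.Compacts X,
      ∃ y ∈ (K : Set X)ᶜ, ∀ᶠ i in l, p i ∈ connectedComponentIn (K : Set X)ᶜ y) :
    ∃ e : TopEnd X, ∀ K, ∀ᶠ i in l, p i ∈ e.comp K := by
  choose y hy hp using h
  refine ⟨⟨fun K => connectedComponentIn (K : Set X)ᶜ (y K), fun K => ⟨y K, hy K, rfl⟩,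
    fun K M hKM => ?_⟩, hp⟩
  obtain ⟨i, hi, hi'⟩ := ((hp K).and (hp M)).exists
  rw [connectedComponentIn_eq hi, connectedComponentIn_eq hi']
  exact connectedComponentIn_mono _ (compl_subset_compl.2 hKM)

theorem ideal_mem_closure {X ι : Type*} [TopologicalSpace X] {l : Filter ι} [l.NeBot]
    {p : ι → X} {e : TopEnd X} (he : ∀ K, ∀ᶠ i in l, p i ∈ e.comp K)
    {V : Set (EndCompactification X)} (hV : ∀ᶠ i in l, EndCompactification.point (p i) ∈ V) :
    EndCompactification.ideal e ∈ closure V := by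
  rw [mem_closure_iff]
  intro W hW heW
  obtain ⟨K, hK⟩ := hW.2 e heW
  obtain ⟨i, hi, hi'⟩ := ((he K).and hV).exists
  exact ⟨_, hK (Or.inl ⟨_, hi, rfl⟩), hi'⟩

theorem EndCompactification.continuous_point (X : Type*) [TopologicalSpace X] :
    Continuous (EndCompactification.point : X → EndCompactification X) :=
  continuous_def.2 fun _ hW => hW.1

/-- A compact `K` lies in a large ball, and a component of `Ω` outside that ball is a connected
subset of the closure that misses `K`. -/
theorem exists_topEnd_of_tendsto_infinity (ho : IsOpen Ω) (hc : IsConnected Ω)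
    (htd : IsTotallyDisconnected (frontier Ω \ localGoldilocksBoundary Ω)) {ι : Type*}
    (𝒰 : Ultrafilter ι) {p : ι → CSpace d} (hp : ∀ i, p i ∈ Ω)
    (hinf : ∀ R, ∀ᶠ i in 𝒰, R < ‖p i‖) :
    ∃ e : TopEnd (closure Ω), ∀ K, ∀ᶠ i in 𝒰, (⟨p i, subset_closure (hp i)⟩ : closure Ω) ∈
      e.comp K := by
  obtain ⟨z₀, hz₀⟩ := hc.nonempty
  refine exists_topEnd_eventually_mem fun K => ?_
  obtain ⟨R, hR⟩ := (K.isCompact.image continuous_subtype_val).isBounded.subset_closedBall 0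
  obtain ⟨w, hw, h⟩ := exists_eventually_mem_connectedComponentIn ho hc htd 𝒰 hp hinf hz₀
    (R := max R (‖z₀‖ + 1)) (lt_max_of_lt_right (by linarith))
  have hsub : ∀ z : closure Ω, (z : CSpace d) ∈ Ω \ Metric.closedBall 0 (max R (‖z₀‖ + 1)) →
      z ∈ (K : Set (closure Ω))ᶜ := fun z hz hzK =>
    hz.2 (Metric.closedBall_subset_closedBall (le_max_left _ _) (hR ⟨z, hzK, rfl⟩))
  refine ⟨⟨w, subset_closure hw.1⟩, hsub _ hw, h.mono fun i hi => ?_⟩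
  set S := connectedComponentIn (Ω \ Metric.closedBall 0 (max R (‖z₀‖ + 1))) w with hS
  have hSsub : S ⊆ Ω \ Metric.closedBall 0 (max R (‖z₀‖ + 1)) := connectedComponentIn_subset _ _
  have hpre : IsPreconnected ((Subtype.val : closure Ω → CSpace d) ⁻¹' S) := by
    rw [← Topology.IsInducing.subtypeVal.isPreconnected_image, image_preimage_eq_of_subset]
    · exact isPreconnected_connectedComponentIn
    · rw [Subtype.range_val]
      exact fun z hz => subset_closure (hSsub hz).1
  exact hpre.subset_connectedComponentIn (mem_connectedComponentIn hw)
    (fun z hz => hsub z (hSsub hz)) hi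

end

/-! ### The visibility theorem -/

theorem theorem1p1 {d : ℕ} (Ω : Set (CSpace d)) (hopen : IsOpen Ω) (hconn : IsConnected Ω)
    (hhyp : IsKobayashiHyperbolic Ω)
    (htd : IsTotallyDisconnected (frontier Ω \ localGoldilocksBoundary Ω)) :
    IsVisibilityDomain Ω := by
  refine ⟨hhyp, fun lam κ hlam _ ξ _ η _ _ Vξ Vη _ _ _ _ hdisj => ?_⟩
  by_contra! hcon
  -- Compact subsets of `Ω`, directed by union, index the counterexamples; an ultrafilter finer than
  -- `atTop` replaces successive passages to subsequences.
  set ι := {K : Set (CSpace d) // IsCompact K ∧ K ⊆ Ω}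
  choose T σ hT hσ h₀ hT' hVξ hVη hemp using fun K : ι => hcon K.1 K.2.1 K.2.2
  have : Nonempty ι := ⟨⟨∅, isCompact_empty, empty_subset _⟩⟩
  have : IsDirectedOrder ι := ⟨fun K M => ⟨⟨K.1 ∪ M.1, K.2.1.union M.2.1, union_subset K.2.2 M.2.2⟩,
    subset_union_left, subset_union_right⟩⟩
  set 𝒰 : Ultrafilter ι := Ultrafilter.of atTop with h𝒰
  have havoid : ∀ K, IsCompact K → K ⊆ Ω → ∀ᶠ i in 𝒰, Disjoint (σ i '' Icc 0 (T i)) K := by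
    intro K hK hKΩ
    have h1 : ∀ᶠ i in (atTop : Filter ι), Disjoint (σ i '' Icc 0 (T i)) K := by
      filter_upwards [eventually_ge_atTop (⟨K, hK, hKΩ⟩ : ι)] with i hi
      exact (Set.disjoint_iff_inter_eq_empty.2 (hemp i)).mono_right hi
    exact Ultrafilter.of_le atTop h1
  have m0 : ∀ i, (0 : ℝ) ∈ Icc 0 (T i) := fun i => left_mem_Icc.2 (hT i)
  have mT : ∀ i, T i ∈ Icc 0 (T i) := fun i => right_mem_Icc.2 (hT i)
  rcases exists_eventually_subset_closedBall_or_eventually_disjoint hopen hconn htd hlam 𝒰 hT hσ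
    havoid with ⟨x, hx, hball⟩ | hinf
  · have hmem : ∀ (V : Set (EndClosure Ω)) (t : ι → ℝ) (ht : ∀ i, t i ∈ Icc 0 (T i)),
        (∀ i, EndClosure.ofMem (σ i (t i)) ((hσ i).mem _ (ht i)) ∈ V) →
        EndCompactification.point ⟨x, hx⟩ ∈ closure V := by
      intro V t ht hV
      have hlim : Tendsto (fun i => (⟨σ i (t i), subset_closure ((hσ i).mem _ (ht i))⟩ :
          closure Ω)) 𝒰 (𝓝 ⟨x, hx⟩) := by
        rw [tendsto_subtype_rng, Metric.nhds_basis_closedBall.tendsto_right_iff]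
        exact fun r hr => (hball r hr).mono fun i hi => hi ⟨t i, ht i, rfl⟩
      exact mem_closure_of_tendsto
        (((EndCompactification.continuous_point _).tendsto _).comp hlim) (Eventually.of_forall hV)
    exact Set.disjoint_left.1 hdisj (hmem Vξ (fun _ => 0) m0 hVξ) (hmem Vη T mT hVη)
  · obtain ⟨e, he⟩ := exists_topEnd_of_tendsto_infinity hopen hconn htd 𝒰 h₀ fun R => by
      filter_upwards [hinf _ (isCompact_closedBall 0 R)] with i hi
      have := Set.disjoint_left.1 hi ⟨0, m0 i, rfl⟩
      simpa using this
    -- Each curve is connected and eventually misses `K`, so both of its endpoints lie in the same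
    -- component.
    have he' : ∀ K, ∀ᶠ i in 𝒰, (⟨σ i (T i), subset_closure (hT' i)⟩ : closure Ω) ∈ e.comp K := by
      intro K
      filter_upwards [he K, hinf _ (K.isCompact.image continuous_subtype_val)] with i hi hi'
      obtain ⟨y, -, hy⟩ := e.isComponent K
      rw [hy] at hi ⊢
      rw [connectedComponentIn_eq hi]
      have hpre : IsPreconnected ((Subtype.val : closure Ω → CSpace d) ⁻¹'
          (σ i '' Icc 0 (T i))) := by
        rw [← Topology.IsInducing.subtypeVal.isPreconnected_image, image_preimage_eq_of_subset]
        · exact isPreconnected_Icc.image _ ((hσ i).continuousOn (hT i))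
        · rw [Subtype.range_val]
          rintro _ ⟨t, ht, rfl⟩
          exact subset_closure ((hσ i).mem t ht)
      exact hpre.subset_connectedComponentIn ⟨0, m0 i, rfl⟩
        (fun z hz hzK => Set.disjoint_left.1 hi' hz ⟨z, hzK, rfl⟩) ⟨T i, mT i, rfl⟩
    exact Set.disjoint_left.1 hdisj (ideal_mem_closure he (Eventually.of_forall hVξ))
      (ideal_mem_closure he' (Eventually.of_forall hVη))
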